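/- Let $T>0$, $l>0$. Put $\mathbb{L}^2=L^2(0,l)\times\mathbb{R}^2$ and $\mathbb{L}^2_T=L^2((0,T)\times(0,l))\times L^2(0,T)$ (real spaces, with the sums of the inner products of the factors), $\mathbb{H}^k=\{(u,u(0),u(l)) : u\in H^k(0,l)\}$ for $k=1,2$ (the norm of $\mathbb{H}^1$ being that of $H^1(0,l)\times\mathbb{R}^2$), and $\mathcal{H}_{\mathrm{en}}=\mathbb{H}^1\times\mathbb{L}^2$. Let $\mathcal{A}$ be the operator on $\mathcal{H}_{\mathrm{en}}$ with domain $\mathbb{H}^2\times\mathbb{H}^1$ given by $\mathcal{A}(Y,Z)=(Z,\mathcal{B}Y)$, where $\mathcal{B}(u,u(0),u(l))=(u_{xx},u_x(0),-u_x(l))$. For $\mathbf{U}_0=(Y_0,Y_1)\in\mathcal{H}_{\mathrm{en}}$ and sources $\mathcal{W}=(F,G)\in\mathbb{L}^2_T$ consider the wave equation with dynamic boundary conditions $$y_{tt}-y_{xx}=F \text{ in } (0,T)\times(0,l),\qquad y_{tt}(t,0)-y_x(t,0)=G(t),\qquad y_{tt}(t,l)+y_x(t,l)=0 \text{ in } (0,T),$$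 with $(y,y(\cdot,0),y(\cdot,l))|_{t=0}=Y_0$ and $(y_t,y_t(\cdot,0),y_t(\cdot,l))|_{t=0}=Y_1$. Its mild solution is the function $$\mathbf{U}(t)=\mathrm{e}^{t\mathcal{A}}\mathbf{U}_0+\int_0^t \mathrm{e}^{(t-s)\mathcal{A}}\bigl(0,(F(s,\cdot),G(s),0)\bigr)\,\mathrm{d}s,\qquad t\in[0,T],$$ with values in $\mathcal{H}_{\mathrm{en}}$, where $(\mathrm{e}^{t\mathcal{A}})_{t\in\mathbb{R}}$ is the strongly continuous group on $\mathcal{H}_{\mathrm{en}}$ generated by $\mathcal{A}$. For every $\mathbf{U}_0\in\mathcal{H}_{\mathrm{en}}$ and $\mathcal{W}\in\mathbb{L}^2_T$ the mild solution exists and is unique on $[0,T]$. Fix $\mathbf{U}_0\in\mathcal{H}_{\mathrm{en}}$ and $Y_T^\delta\in\mathbb{L}^2$, let $Y(t,\cdot,\mathcal{W})=(y(t,\cdot),y(t,0),y(t,l))$ be the first component of the mild solution with sources $\mathcal{W}$, and set $$\mathcal{J}(\mathcal{W})=\tfrac12\,\|Y(T,\cdot,\mathcal{W})-Y_T^\delta\|_{\mathbb{L}^2}^2,\qquad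 \mathcal{W}\in\mathbb{L}^2_T .$$ Then $\mathcal{J}$ is continuously Fréchet differentiable on $\mathbb{L}^2_T$, and its gradient $\mathcal{J}'$ satisfies, for all $\mathcal{W},\delta\mathcal{W}\in\mathbb{L}^2_T$, $$\langle\mathcal{J}'(\mathcal{W}+\delta\mathcal{W})-\mathcal{J}'(\mathcal{W}),\,\delta\mathcal{W}\rangle_{\mathbb{L}^2_T}=\|\delta Y(T,\cdot,\mathcal{W})\|_{\mathbb{L}^2}^2,$$ where $\delta Y$ is the first component of the mild solution of the same system with zero initial state and sources $\delta\mathcal{W}$; this mild solution is, on $[0,T]$, the difference of the mild solutions with initial state $\mathbf{U}_0$ and sources $\mathcal{W}+\delta\mathcal{W}$ and $\mathcal{W}$. Hence $\mathcal{J}'$ is monotone, i.e. $\langle\mathcal{J}'(\mathcal{W}_1)-\mathcal{J}'(\mathcal{W}_2),\mathcal{W}_1-\mathcal{W}_2\rangle_{\mathbb{L}^2_T}\ge0$ for all $\mathcal{W}_1,\mathcal{W}_2\in\mathbb{L}^2_T$; $\mathcal{J}$ is convex; and $\mathcal{J}'$ is strictly monotone wherever $\delta Y(T)\neq0$, i.e.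 $\langle\mathcal{J}'(\mathcal{W}+\delta\mathcal{W})-\mathcal{J}'(\mathcal{W}),\delta\mathcal{W}\rangle_{\mathbb{L}^2_T}>0$ whenever $\delta Y(T,\cdot,\mathcal{W})\neq0$. -/

import Mathlib

open MeasureTheory Set Filter Topology
open scoped ContDiff

namespace DynWave

noncomputable section

/-- The real Lebesgue space `L²(0,l)`. -/
abbrev L2Int (l : ℝ) : Type := Lp ℝ 2 (volume.restrict (Ioo (0 : ℝ) l))

/-- The space `𝕃² = L²(0,l) × ℝ²` with the inner product
`⟨y,z⟩_{L²(0,l)} + a c + b d`; an element `u` is the triple `(u.fst, u.snd.fst, u.snd.snd)`. -/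
abbrev L2Space (l : ℝ) : Type := WithLp 2 (L2Int l × WithLp 2 (ℝ × ℝ))

/-- The space `𝕃²_T = L²((0,T)×(0,l)) × L²(0,T)` of sources `W = (F,G)`,
with the sum of the two inner products. -/
abbrev Sources (T l : ℝ) : Type :=
  WithLp 2 (Lp ℝ 2 (volume.restrict (Ioo (0 : ℝ) T ×ˢ Ioo (0 : ℝ) l)) ×
    Lp ℝ 2 (volume.restrict (Ioo (0 : ℝ) T)))

/-- `g` is the weak (distributional) derivative of `y` on `(0,l)`. -/
def HasWeakDeriv (l : ℝ) (y g : L2Int l) : Prop :=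
  ∀ φ : ℝ → ℝ, ContDiff ℝ ∞ φ → HasCompactSupport φ → tsupport φ ⊆ Ioo 0 l →
    ∫ x in Ioo 0 l, y x * deriv φ x = -∫ x in Ioo 0 l, g x * φ x

/-- The continuous representative of `y` on `[0,l]` exists and takes the values `a` at `0` and
`b` at `l`. -/
def HasBoundaryValues (l : ℝ) (y : L2Int l) (a b : ℝ) : Prop :=
  ∃ w : ℝ → ℝ, ContinuousOn w (Icc 0 l) ∧ y =ᵐ[volume.restrict (Ioo 0 l)] w ∧ w 0 = a ∧ w l = b

theorem integrable_mul_test {l : ℝ} (y : L2Int l) {ψ : ℝ → ℝ} (hψ : Continuous ψ)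
    (hc : HasCompactSupport ψ) : Integrable (fun x => y x * ψ x) (volume.restrict (Ioo 0 l)) := by
  have hy : Integrable y (volume.restrict (Ioo 0 l)) := (Lp.memLp y).integrable (by norm_num)
  obtain ⟨C, hC⟩ := hc.exists_bound_of_continuous hψ
  exact hy.mul_bdd hψ.aestronglyMeasurable (Eventually.of_forall hC)

theorem HasWeakDeriv.add {l : ℝ} {y g z h : L2Int l} (h₁ : HasWeakDeriv l y g)
    (h₂ : HasWeakDeriv l z h) : HasWeakDeriv l (y + z) (g + h) := by
  intro φ hφ hc hs
  have hd : Continuous (deriv φ) := hφ.continuous_deriv (by simp)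
  have e₁ : ∫ x in Ioo 0 l, (y + z : L2Int l) x * deriv φ x
      = ∫ x in Ioo 0 l, (y x * deriv φ x + z x * deriv φ x) := by
    refine integral_congr_ae ?_
    filter_upwards [Lp.coeFn_add y z] with x hx
    rw [hx, Pi.add_apply, add_mul]
  have e₂ : ∫ x in Ioo 0 l, (g + h : L2Int l) x * φ x
      = ∫ x in Ioo 0 l, (g x * φ x + h x * φ x) := by
    refine integral_congr_ae ?_
    filter_upwards [Lp.coeFn_add g h] with x hx
    rw [hx, Pi.add_apply, add_mul]
  rw [e₁, e₂, integral_add (integrable_mul_test y hd hc.deriv) (integrable_mul_test z hd hc.deriv),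
    integral_add (integrable_mul_test g hφ.continuous hc)
      (integrable_mul_test h hφ.continuous hc), h₁ φ hφ hc hs, h₂ φ hφ hc hs]
  ring

theorem HasWeakDeriv.smul {l : ℝ} {y g : L2Int l} (c : ℝ) (h₁ : HasWeakDeriv l y g) :
    HasWeakDeriv l (c • y) (c • g) := by
  intro φ hφ hc hs
  have e₁ : ∫ x in Ioo 0 l, (c • y : L2Int l) x * deriv φ x
      = ∫ x in Ioo 0 l, c * (y x * deriv φ x) := by
    refine integral_congr_ae ?_
    filter_upwards [Lp.coeFn_smul c y] with x hx
    rw [hx, Pi.smul_apply, smul_eq_mul, mul_assoc]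
  have e₂ : ∫ x in Ioo 0 l, (c • g : L2Int l) x * φ x = ∫ x in Ioo 0 l, c * (g x * φ x) := by
    refine integral_congr_ae ?_
    filter_upwards [Lp.coeFn_smul c g] with x hx
    rw [hx, Pi.smul_apply, smul_eq_mul, mul_assoc]
  rw [e₁, e₂, integral_const_mul, integral_const_mul, h₁ φ hφ hc hs]
  ring

theorem HasBoundaryValues.add {l : ℝ} {y z : L2Int l} {a b c d : ℝ}
    (h₁ : HasBoundaryValues l y a b) (h₂ : HasBoundaryValues l z c d) :
    HasBoundaryValues l (y + z) (a + c) (b + d) := by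
  obtain ⟨v, hv, hyv, rfl, rfl⟩ := h₁
  obtain ⟨w, hw, hzw, rfl, rfl⟩ := h₂
  refine ⟨v + w, hv.add hw, ?_, rfl, rfl⟩
  filter_upwards [Lp.coeFn_add y z, hyv, hzw] with x hx h₁ h₂
  rw [hx, Pi.add_apply, Pi.add_apply, h₁, h₂]

theorem HasBoundaryValues.smul {l : ℝ} {y : L2Int l} {a b : ℝ} (c : ℝ)
    (h₁ : HasBoundaryValues l y a b) : HasBoundaryValues l (c • y) (c * a) (c * b) := by
  obtain ⟨v, hv, hyv, rfl, rfl⟩ := h₁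
  refine ⟨c • v, hv.const_smul c, ?_, rfl, rfl⟩
  filter_upwards [Lp.coeFn_smul c y, hyv] with x hx h₁
  rw [hx, Pi.smul_apply, Pi.smul_apply, h₁]

/-- The space `ℍ¹ = {(u, u(0), u(l)) : u ∈ H¹(0,l)}`. An element is stored together with its weak
derivative, as `((u, u(0), u(l)), u_x) ∈ 𝕃² × L²(0,l)`; the norm inherited from the product is
the norm of `H¹(0,l) × ℝ²`. -/
def H1 (l : ℝ) : Submodule ℝ (WithLp 2 (L2Space l × L2Int l)) where
  carrier := {p | HasWeakDeriv l p.fst.fst p.snd ∧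
    HasBoundaryValues l p.fst.fst p.fst.snd.fst p.fst.snd.snd}
  add_mem' := fun h₁ h₂ => ⟨h₁.1.add h₂.1, h₁.2.add h₂.2⟩
  zero_mem' := by
    have h₀ : ((0 : L2Int l) : ℝ → ℝ) =ᵐ[volume.restrict (Ioo 0 l)] 0 := Lp.coeFn_zero _ _ _
    refine ⟨fun φ _ _ _ => ?_, 0, continuousOn_const, h₀, rfl, rfl⟩
    have e : ∀ ψ : ℝ → ℝ, ∫ x in Ioo 0 l, (0 : L2Int l) x * ψ x = 0 := fun ψ => by
      refine integral_eq_zero_of_ae ?_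
      filter_upwards [h₀] with x hx
      rw [hx, Pi.zero_apply]
      exact zero_mul _
    exact (e _).trans (neg_eq_zero.mpr (e φ)).symm
  smul_mem' := fun c _ h => ⟨h.1.smul c, h.2.smul c⟩

/-- The triple `(u, u(0), u(l)) ∈ 𝕃²` of an element of `ℍ¹`. -/
def toL2 {l : ℝ} (u : H1 l) : L2Space l := (u : WithLp 2 (L2Space l × L2Int l)).fst

/-- The weak derivative `u_x ∈ L²(0,l)` of an element of `ℍ¹`. -/
def dx {l : ℝ} (u : H1 l) : L2Int l := (u : WithLp 2 (L2Space l × L2Int l)).snd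

/-- The energy phase space `ℋ_en = ℍ¹ × 𝕃²`; its elements are `(Y, Y_t)`, the displacement and the
velocity (the norm of the product is equivalent to the sum of the two norms). -/
abbrev EnergySpace (l : ℝ) : Type := H1 l × L2Space l

/-- The graph of the operator `𝒜 = [[0, I], [ℬ, 0]]` on `ℋ_en`, with domain `ℍ² × ℍ¹`:
`WaveOp l U V` says that `U ∈ D(𝒜)` and `𝒜 U = V`. Here `ℬ (u, u(0), u(l)) =
(u_xx, u_x(0), -u_x(l))` on `ℍ²`, that is, `u_x` is in `H¹(0,l)`, with weak derivative `u_xx` and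
boundary values `u_x(0)`, `u_x(l)`. -/
def WaveOp (l : ℝ) (U V : EnergySpace l) : Prop :=
  toL2 V.1 = U.2 ∧
    ∃ p : H1 l, (toL2 p).fst = dx U.1 ∧ V.2.fst = dx p ∧
      V.2.snd.fst = (toL2 p).snd.fst ∧ V.2.snd.snd = -(toL2 p).snd.snd

/-- `S` is the strongly continuous group `(e^{t𝒜})_{t ∈ ℝ}` on `ℋ_en`: a strongly continuous group
of bounded operators with infinitesimal generator `𝒜` (equality of operators, with domains). -/
structure IsWaveGroup (l : ℝ) (S : ℝ → EnergySpace l →L[ℝ] EnergySpace l) : Prop where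
  map_zero : S 0 = ContinuousLinearMap.id ℝ (EnergySpace l)
  map_add : ∀ s t : ℝ, S (s + t) = (S s).comp (S t)
  strongly_continuous : ∀ U : EnergySpace l, Continuous fun t => S t U
  generator : ∀ U V : EnergySpace l,
    Tendsto (fun t : ℝ => t⁻¹ • (S t U - U)) (𝓝[≠] 0) (𝓝 V) ↔ WaveOp l U V

open Classical in
/-- The slice `F(t,·) ∈ L²(0,l)` of `F ∈ L²((0,T)×(0,l))`, meaningful for almost every
`t ∈ (0,T)`. -/
def slice {T l : ℝ} (F : Lp ℝ 2 (volume.restrict (Ioo (0 : ℝ) T ×ˢ Ioo (0 : ℝ) l))) (t : ℝ) :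
    L2Int l :=
  if h : MemLp (fun x => F (t, x)) 2 (volume.restrict (Ioo (0 : ℝ) l)) then h.toLp _ else 0

/-- The source term `ℱ(t) = (0, 0, 0, F(t,·), G(t), 0) ∈ ℋ_en`. -/
def forcing {T l : ℝ} (W : Sources T l) (t : ℝ) : EnergySpace l :=
  (0, WithLp.toLp 2 (slice W.fst t, WithLp.toLp 2 (W.snd t, 0)))

/-- `U : [0,T] → ℋ_en` is the mild solution, with initial state `U₀ = (Y₀, Y₁)` and sources
`W = (F,G)`, of the wave equation
`y_tt - y_xx = F`, `y_tt(t,0) - y_x(t,0) = G`, `y_tt(t,l) + y_x(t,l) = 0`, that is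
`U(t) = e^{t𝒜} U₀ + ∫₀ᵗ e^{(t-s)𝒜} ℱ(s) ds` for all `t ∈ [0,T]`. -/
def IsMildSolution {T l : ℝ} (U₀ : EnergySpace l) (W : Sources T l) (U : ℝ → EnergySpace l) :
    Prop :=
  ∃ S : ℝ → EnergySpace l →L[ℝ] EnergySpace l, IsWaveGroup l S ∧
    ∀ t ∈ Icc 0 T, IntervalIntegrable (fun s => S (t - s) (forcing W s)) volume 0 t ∧
      U t = S t U₀ + ∫ s in (0 : ℝ)..t, S (t - s) (forcing W s)

/-- The displacement triple `Y(t) = (y(t,·), y(t,0), y(t,l)) ∈ 𝕃²` of a trajectory in `ℋ_en`. -/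
def displacement {l : ℝ} (U : ℝ → EnergySpace l) (t : ℝ) : L2Space l := toL2 (U t).1

/-- The cost functional `𝒥(W) = ½ ‖Y(T,·,W) - Y_T^δ‖²_{𝕃²}`, where `U W` is the trajectory
with sources `W`. -/
def cost {T l : ℝ} (U : Sources T l → ℝ → EnergySpace l) (Yδ : L2Space l) (W : Sources T l) : ℝ :=
  1 / 2 * ‖displacement (U W) T - Yδ‖ ^ 2

end

end DynWave

/-! By linearity the displacement at time `T` is an affine function of the sources: it equals the
free evolution of the initial state plus `K W`, where `K` is the bounded
source-to-final-displacement operator. Hence the cost is `½ ‖K W + b‖²` with `b` fixed, its gradient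
is `K* (K W + b)`, and differences of gradients paired with differences of sources give `‖K δW‖²`.
Smoothness, the identity, monotonicity and convexity all follow, and `K δW` is the final
displacement of the sensitivity problem.

The substance lies in making the mild solution well defined: the wave operator must be shown to
generate a group, and only one. In the Hilbert norm of `ℍ¹ × 𝕃²` it is not skew, but the derivative
terms cancel in `⟨𝒜U, U⟩`, leaving a term bounded by `‖U‖²` (`isQuasiSkew_waveGraph`); the resolvent
equation reduces to an elliptic problem solved by Lax–Milgram. An abstract Yosida-type argument
(`IsQuasiSkew.exists_group`) then produces the group, and a Gronwall estimate gives uniqueness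
(`IsQuasiSkew.group_unique`). Integration by parts characterizes `ℍ¹` (`mem_H1_iff`), which yields
both its completeness and the weak form of `𝒜`.

Boundedness of `K` comes from Tonelli for the time slices of `F`, Cauchy–Schwarz in time and the
exponential growth bound of the group (`exists_duhamel_clm`). -/

namespace DynWave

/-! ### Groups as strong limits of exponentials of commuting bounded operators -/

section Generation

open NormedSpace
open scoped InnerProductSpace

variable {X : Type*} [NormedAddCommGroup X] [InnerProductSpace ℝ X]

/-- Gronwall's inequality for a curve whose velocity is controlled in the energy sense. -/
theorem norm_le_exp_mul_of_inner_deriv_le {u u' : ℝ → X} {C : ℝ}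
    (hu : ∀ t, HasDerivAt u (u' t) t) (h : ∀ t, ⟪u' t, u t⟫_ℝ ≤ C * ‖u t‖ ^ 2) {t : ℝ}
    (ht : 0 ≤ t) : ‖u t‖ ≤ Real.exp (C * t) * ‖u 0‖ := by
  have hd : ∀ s, HasDerivAt (fun s => Real.exp (-(2 * C) * s) * ‖u s‖ ^ 2)
      (Real.exp (-(2 * C) * s) * (2 * ⟪u' s, u s⟫_ℝ - 2 * C * ‖u s‖ ^ 2)) s := fun s => by
    have h1 : HasDerivAt (fun s : ℝ => Real.exp (-(2 * C) * s))
        (Real.exp (-(2 * C) * s) * (-(2 * C))) s := by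
      simpa using ((hasDerivAt_id s).const_mul (-(2 * C))).exp
    have h2 := (hu s).norm_sq
    refine (h1.mul h2).congr_deriv ?_
    rw [real_inner_comm]
    ring
  have ha : Antitone fun s => Real.exp (-(2 * C) * s) * ‖u s‖ ^ 2 :=
    antitone_of_hasDerivAt_nonpos hd fun s =>
      mul_nonpos_of_nonneg_of_nonpos (Real.exp_pos _).le (by have := h s; simp; linarith)
  have h0 := ha ht
  simp only [mul_zero, Real.exp_zero, one_mul] at h0
  have h1 : ‖u t‖ ^ 2 ≤ (Real.exp (C * t) * ‖u 0‖) ^ 2 := by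
    have e : Real.exp (C * t) ^ 2 * Real.exp (-(2 * C) * t) = 1 := by
      rw [← Real.exp_nat_mul, ← Real.exp_add]
      simp; ring_nf
    calc ‖u t‖ ^ 2 = Real.exp (C * t) ^ 2 * (Real.exp (-(2 * C) * t) * ‖u t‖ ^ 2) := by
          rw [← mul_assoc, e, one_mul]
      _ ≤ Real.exp (C * t) ^ 2 * ‖u 0‖ ^ 2 := by gcongr
      _ = _ := by ring
  exact le_of_sq_le_sq h1 (by positivity)

/-- The two-sided version of `norm_le_exp_mul_of_inner_deriv_le`. -/
theorem norm_le_exp_mul_abs_of_inner_deriv_le {u u' : ℝ → X} {C : ℝ}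
    (hu : ∀ t, HasDerivAt u (u' t) t) (h : ∀ t, |⟪u' t, u t⟫_ℝ| ≤ C * ‖u t‖ ^ 2) (t : ℝ) :
    ‖u t‖ ≤ Real.exp (C * |t|) * ‖u 0‖ := by
  rcases le_total 0 t with ht | ht
  · rw [abs_of_nonneg ht]
    exact norm_le_exp_mul_of_inner_deriv_le hu (fun s => (le_abs_self _).trans (h s)) ht
  · rw [abs_of_nonpos ht]
    have hv : ∀ s, HasDerivAt (fun s => u (-s)) (-u' (-s)) s := fun s => by
      simpa [Function.comp_def] using (hu (-s)).scomp s (hasDerivAt_neg s)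
    have := norm_le_exp_mul_of_inner_deriv_le hv (C := C) (fun s => by
      rw [inner_neg_left]
      exact (neg_le_abs _).trans (h (-s))) (neg_nonneg.2 ht)
    simpa using this

theorem exp_smul_apply_comm (B : X →L[ℝ] X) (x : X) (t : ℝ) :
    exp (t • B) (B x) = B (exp (t • B) x) := by
  have h : Commute B (exp (t • B)) := ((Commute.refl B).smul_right t).exp_right
  exact (DFunLike.congr_fun h.eq x).symm

variable [CompleteSpace X]

theorem hasDerivAt_exp_smul_apply (B : X →L[ℝ] X) (x : X) (t : ℝ) :
    HasDerivAt (fun s : ℝ => exp (s • B) x) (exp (t • B) (B x)) t := by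
  have h := (hasDerivAt_exp_smul_const (𝕂 := ℝ) B t)
  exact h.clm_apply (hasDerivAt_const t x) |>.congr_deriv (by simp)

/-- Only the form bound enters, not the operator norm of `B`, so the estimate is uniform along
approximations whose norms blow up. -/
theorem norm_exp_smul_apply_le {B : X →L[ℝ] X} {C : ℝ}
    (hB : ∀ z, |⟪B z, z⟫_ℝ| ≤ C * ‖z‖ ^ 2) (t : ℝ) (x : X) :
    ‖exp (t • B) x‖ ≤ Real.exp (C * |t|) * ‖x‖ := by
  have := norm_le_exp_mul_abs_of_inner_deriv_le (hasDerivAt_exp_smul_apply B x) (C := C)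
    (fun s => by rw [exp_smul_apply_comm]; exact hB _) t
  simpa using this

/-- Mean value inequality: the orbit has velocity `exp (s • B) (B x)`, controlled by the previous
growth bound. -/
theorem norm_exp_smul_apply_sub_le {B : X →L[ℝ] X} {C : ℝ} (hC : 0 ≤ C)
    (hB : ∀ z, |⟪B z, z⟫_ℝ| ≤ C * ‖z‖ ^ 2) (t : ℝ) (x : X) :
    ‖exp (t • B) x - x‖ ≤ |t| * Real.exp (C * |t|) * ‖B x‖ := by
  have := (convex_uIcc 0 t).norm_image_sub_le_of_norm_hasDerivWithin_le
    (f := fun s : ℝ => exp (s • B) x) (C := Real.exp (C * |t|) * ‖B x‖)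
    (fun s _ => (hasDerivAt_exp_smul_apply B x s).hasDerivWithinAt)
    (fun s hs => (norm_exp_smul_apply_le hB s (B x)).trans (by
      have : |s| ≤ |t| := by simpa using abs_sub_left_of_mem_uIcc hs
      gcongr)) left_mem_uIcc right_mem_uIcc
  simp only [zero_smul, exp_zero, sub_zero, Real.norm_eq_abs] at this
  calc _ ≤ _ := this
    _ = _ := by ring

/-- The exponentials of commuting bounded operators `B n` with a common energy bound, converging
on a dense set, converge strongly to a group. -/
theorem exists_limit_group {B : ℕ → X →L[ℝ] X} {C : ℝ} (hC : 0 ≤ C)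
    (hcomm : ∀ n m, Commute (B n) (B m)) (hB : ∀ n z, |⟪B n z, z⟫_ℝ| ≤ C * ‖z‖ ^ 2)
    {D : Set X} (hD : Dense D) (hconv : ∀ x ∈ D, ∃ y, Tendsto (fun n => B n x) atTop (𝓝 y)) :
    ∃ S : ℝ → X →L[ℝ] X, S 0 = ContinuousLinearMap.id ℝ X ∧
      (∀ s t, S (s + t) = (S s).comp (S t)) ∧
      (∀ t x, ‖S t x‖ ≤ Real.exp (C * |t|) * ‖x‖) ∧
      (∀ x, Continuous fun t => S t x) ∧
      ∀ x y, Tendsto (fun n => B n x) atTop (𝓝 y) →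
        ∀ t, S t x - x = ∫ s in (0 : ℝ)..t, S s y := by
  let _ : NormedAlgebra ℚ (X →L[ℝ] X) := NormedAlgebra.restrictScalars ℚ ℝ _
  have hcau : ∀ (t : ℝ) (x : X), CauchySeq fun n => exp (t • B n) x := by
    intro t x
    set M := Real.exp (C * |t|) with hM
    have hMpos : 0 < M := Real.exp_pos _
    -- Commutativity allows factoring out `exp (t • B m)`. What remains is the exponential of `B n -
    -- B m`, whose form bound is `2 * C`, and its deviation from the identity at `z` is controlled
    -- by `(B n - B m) z`.
    have hdiff : ∀ n m z, ‖exp (t • B n) z - exp (t • B m) z‖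
        ≤ M * (|t| * Real.exp (2 * C * |t|)) * ‖B n z - B m z‖ := by
      intro n m z
      have e : exp (t • B n) = exp (t • B m) * exp (t • (B n - B m)) := by
        have hc : Commute (t • B m) (t • (B n - B m)) :=
          (((hcomm m n).sub_right (Commute.refl _)).smul_left t).smul_right t
        rw [← exp_add_of_commute hc]
        congr 1
        rw [smul_sub]; abel
      have e2 : exp (t • B n) z - exp (t • B m) z
          = exp (t • B m) (exp (t • (B n - B m)) z - z) := by
        rw [e, map_sub]; rfl
      rw [e2]
      refine (norm_exp_smul_apply_le (hB m) t _).trans ?_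
      rw [mul_assoc M]
      gcongr
      refine norm_exp_smul_apply_sub_le (C := 2 * C) (by positivity) (fun w => ?_) t z
      rw [sub_apply, inner_sub_left]
      have h1 := hB n w
      have h2 := hB m w
      have := abs_sub (⟪B n w, w⟫_ℝ) (⟪B m w, w⟫_ℝ)
      linarith
    rw [Metric.cauchySeq_iff']
    intro ε hε
    obtain ⟨z, hzD, hz⟩ := hD.exists_dist_lt x (ε := ε / (4 * M)) (by positivity)
    have hcz : CauchySeq fun n => exp (t • B n) z := by
      obtain ⟨y, hy⟩ := hconv z hzD
      rw [Metric.cauchySeq_iff']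
      intro δ hδ
      -- The summand 1 keeps `K` positive when `t = 0`.
      set K := M * (|t| * Real.exp (2 * C * |t|)) + 1 with hK
      have hKpos : 0 < K := by positivity
      obtain ⟨N, hN⟩ := Metric.cauchySeq_iff'.1 hy.cauchySeq (δ / K) (by positivity)
      refine ⟨N, fun n hn => ?_⟩
      rw [dist_eq_norm]
      have h1 := hN n hn
      rw [dist_eq_norm, lt_div_iff₀ hKpos] at h1
      have h2 := hdiff n N z
      have : 0 ≤ ‖B n z - B N z‖ := norm_nonneg _
      nlinarith
    obtain ⟨N, hN⟩ := Metric.cauchySeq_iff'.1 hcz (ε / 2) (by positivity)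
    refine ⟨N, fun n hn => ?_⟩
    have h3 := hN n hn
    rw [dist_eq_norm] at h3 hz ⊢
    have hb : ∀ k, ‖exp (t • B k) (x - z)‖ ≤ ε / 4 := fun k => by
      refine (norm_exp_smul_apply_le (hB k) t _).trans ?_
      have := hz.le
      calc M * ‖x - z‖ ≤ M * (ε / (4 * M)) := by gcongr
        _ = ε / 4 := by field_simp
    have e : exp (t • B n) x - exp (t • B N) x
        = exp (t • B n) (x - z) + (exp (t • B n) z - exp (t • B N) z)
          - exp (t • B N) (x - z) := by
      rw [map_sub, map_sub]; abel
    rw [e]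
    have := norm_sub_le (exp (t • B n) (x - z) + (exp (t • B n) z - exp (t • B N) z))
      (exp (t • B N) (x - z))
    have := norm_add_le (exp (t • B n) (x - z)) (exp (t • B n) z - exp (t • B N) z)
    have := hb n
    have := hb N
    linarith
  choose f hf using fun t x => cauchySeq_tendsto_of_complete (hcau t x)
  set S : ℝ → X →L[ℝ] X := fun t =>
    continuousLinearMapOfTendsto (fun n => exp (t • B n)) (tendsto_pi_nhds.2 (hf t)) with hSdef
  have hS : ∀ t x, Tendsto (fun n => exp (t • B n) x) atTop (𝓝 (S t x)) := hf
  have hbd : ∀ t x, ‖S t x‖ ≤ Real.exp (C * |t|) * ‖x‖ := fun t x =>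
    le_of_tendsto (hS t x).norm (Eventually.of_forall fun n => norm_exp_smul_apply_le (hB n) t x)
  have h0 : S 0 = ContinuousLinearMap.id ℝ X := by
    ext x
    refine tendsto_nhds_unique (hS 0 x) ?_
    simp
  have hadd : ∀ s t, S (s + t) = (S s).comp (S t) := by
    intro s t
    ext x
    refine tendsto_nhds_unique (hS (s + t) x) ?_
    have e : ∀ n, exp ((s + t) • B n) x
        = exp (s • B n) (S t x) + exp (s • B n) (exp (t • B n) x - S t x) := fun n => by
      rw [add_smul, exp_add_of_commute (((Commute.refl (B n)).smul_left s).smul_right t), map_sub]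
      simp
    simp_rw [e]
    have h1 : Tendsto (fun n => exp (s • B n) (exp (t • B n) x - S t x)) atTop (𝓝 0) := by
      refine squeeze_zero_norm (fun n => norm_exp_smul_apply_le (hB n) s _) ?_
      have := ((hS t x).sub_const (S t x)).norm.const_mul (Real.exp (C * |s|))
      simpa using this
    simpa using (hS s (S t x)).add h1
  have hsub : ∀ x y, Tendsto (fun n => B n x) atTop (𝓝 y) → ∀ t,
      ‖S t x - x‖ ≤ |t| * Real.exp (C * |t|) * ‖y‖ := fun x y hxy t =>
    le_of_tendsto_of_tendsto ((hS t x).sub_const x).norm (hxy.norm.const_mul _)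
      (Eventually.of_forall fun n => norm_exp_smul_apply_sub_le hC (hB n) t x)
  have hc0 : ∀ x, Tendsto (fun t => S t x) (𝓝 0) (𝓝 x) := by
    intro x
    rw [Metric.tendsto_nhds]
    intro ε hε
    -- `M` bounds the operators for `|t| ≤ 1`, so strong continuity at 0 passes from the dense set
    -- to all vectors.
    set M := Real.exp C with hM
    have hMpos : 0 < M := Real.exp_pos _
    obtain ⟨z, hzD, hz⟩ := hD.exists_dist_lt x (ε := ε / (3 * (M + 1))) (by positivity)
    obtain ⟨y, hy⟩ := hconv z hzD
    have hlim : Tendsto (fun t : ℝ => |t| * Real.exp (C * |t|) * ‖y‖) (𝓝 0) (𝓝 0) := by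
      have : Continuous fun t : ℝ => |t| * Real.exp (C * |t|) * ‖y‖ := by fun_prop
      simpa using this.tendsto 0
    filter_upwards [(Metric.tendsto_nhds.1 hlim) (ε / 3) (by positivity),
      Metric.ball_mem_nhds (0 : ℝ) one_pos] with t ht1 ht2
    simp only [Metric.mem_ball, dist_zero_right, Real.norm_eq_abs] at ht1 ht2
    have h1 : ‖S t z - z‖ < ε / 3 := (hsub z y hy t).trans_lt ((le_abs_self _).trans_lt ht1)
    have h2 : ‖S t (x - z)‖ ≤ M * ‖x - z‖ := (hbd t _).trans (by
      gcongr
      exact Real.exp_le_exp.2 (mul_le_of_le_one_right hC ht2.le))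
    rw [dist_eq_norm] at hz ⊢
    have h3 : (M + 1) * ‖x - z‖ < ε / 3 := by
      rw [lt_div_iff₀ (by positivity)] at hz
      linarith
    have e : S t x - x = S t (x - z) + (S t z - z) - (x - z) := by rw [map_sub]; abel
    rw [e]
    have := norm_sub_le (S t (x - z) + (S t z - z)) (x - z)
    have := norm_add_le (S t (x - z)) (S t z - z)
    nlinarith
  have hcont : ∀ x, Continuous fun t => S t x := by
    intro x
    rw [continuous_iff_continuousAt]
    intro t₀
    have e : (fun t => S t x) = fun t => S t₀ (S (t - t₀) x) := by
      ext t
      rw [← ContinuousLinearMap.comp_apply, ← hadd, add_sub_cancel]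
    rw [ContinuousAt, e]
    have h1 : Tendsto (fun t => t - t₀) (𝓝 t₀) (𝓝 0) := by
      have : Continuous fun t : ℝ => t - t₀ := by fun_prop
      simpa using this.tendsto t₀
    have := ((S t₀).continuous.tendsto x).comp ((hc0 x).comp h1)
    simpa [h0, Function.comp_def] using this
  refine ⟨S, h0, hadd, hbd, hcont, fun x y hxy t => ?_⟩
  -- The integral identity holds for each approximation and passes to the limit by dominated
  -- convergence.
  have hint : ∀ n, exp (t • B n) x - x = ∫ s in (0 : ℝ)..t, exp (s • B n) (B n x) := fun n => by
    have hcn : Continuous fun s : ℝ => exp (s • B n) (B n x) :=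
      continuous_iff_continuousAt.2 fun s => (hasDerivAt_exp_smul_apply (B n) (B n x) s).continuousAt
    rw [intervalIntegral.integral_eq_sub_of_hasDerivAt
      (fun s _ => hasDerivAt_exp_smul_apply (B n) x s) (hcn.intervalIntegrable _ _)]
    simp
  have hl : Tendsto (fun n => exp (t • B n) x - x) atTop (𝓝 (S t x - x)) := (hS t x).sub_const x
  refine tendsto_nhds_unique hl ?_
  simp_rw [hint]
  obtain ⟨K, hK⟩ := hxy.norm.bddAbove_range
  refine intervalIntegral.tendsto_integral_filter_of_dominated_convergence
    (fun _ => Real.exp (C * |t|) * K) (Eventually.of_forall fun n => ?_)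
    (Eventually.of_forall fun n => Eventually.of_forall fun s hs => ?_)
    intervalIntegrable_const (Eventually.of_forall fun s _ => ?_)
  · have hcn : Continuous fun s : ℝ => exp (s • B n) (B n x) :=
      continuous_iff_continuousAt.2 fun s => (hasDerivAt_exp_smul_apply (B n) (B n x) s).continuousAt
    exact hcn.aestronglyMeasurable
  · refine (norm_exp_smul_apply_le (hB n) s _).trans ?_
    have h1 : |s| ≤ |t| := by simpa using abs_sub_left_of_mem_uIcc (uIoc_subset_uIcc hs)
    have h2 : ‖B n x‖ ≤ K := hK ⟨n, rfl⟩
    gcongr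
  · have e : ∀ n, exp (s • B n) (B n x) = exp (s • B n) y + exp (s • B n) (B n x - y) := fun n => by
      rw [map_sub]; abel
    simp_rw [e]
    have h1 : Tendsto (fun n => exp (s • B n) (B n x - y)) atTop (𝓝 0) := by
      refine squeeze_zero_norm (fun n => norm_exp_smul_apply_le (hB n) s _) ?_
      have := (hxy.sub_const y).norm.const_mul (Real.exp (C * |s|))
      simpa using this
    simpa using (hS s y).add h1

end Generation

/-! ### Resolvents and generation for operators skew up to a bounded form -/

section QuasiSkew

open scoped InnerProductSpace

variable {X : Type*} [NormedAddCommGroup X] [InnerProductSpace ℝ X]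

/-- `G` is the graph of an operator that is skew-symmetric up to a form bound `κ`, and whose
resolvent set contains all real numbers `ε⁻¹` with `|ε| κ ≤ 1/2`. -/
structure IsQuasiSkew (G : Submodule ℝ (X × X)) (κ : ℝ) : Prop where
  nonneg : 0 ≤ κ
  single : ∀ y, ((0 : X), y) ∈ G → y = 0
  bound : ∀ x y, (x, y) ∈ G → |⟪y, x⟫_ℝ| ≤ κ * ‖x‖ ^ 2
  surj : ∀ ε : ℝ, ε ≠ 0 → |ε| * κ ≤ 1 / 2 → ∀ z, ∃ x y, (x, y) ∈ G ∧ x - ε • y = z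

namespace IsQuasiSkew

variable {G : Submodule ℝ (X × X)} {κ : ℝ}

/-- Pair `x - ε • y` with `x`: the term `ε ⟪y, x⟫` absorbs at most half of `‖x‖ ^ 2`. -/
theorem norm_le (h : IsQuasiSkew G κ) {ε : ℝ} (hε : |ε| * κ ≤ 1 / 2) {x y : X}
    (hxy : (x, y) ∈ G) : ‖x‖ ≤ 2 * ‖x - ε • y‖ := by
  have e : ‖x‖ ^ 2 = ⟪x - ε • y, x⟫_ℝ + ε * ⟪y, x⟫_ℝ := by
    rw [inner_sub_left, inner_smul_left, real_inner_self_eq_norm_sq]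
    simp
  have h1 := real_inner_le_norm (x - ε • y) x
  have h2 : ε * ⟪y, x⟫_ℝ ≤ 1 / 2 * ‖x‖ ^ 2 := by
    calc ε * ⟪y, x⟫_ℝ ≤ |ε * ⟪y, x⟫_ℝ| := le_abs_self _
      _ = |ε| * |⟪y, x⟫_ℝ| := abs_mul _ _
      _ ≤ |ε| * (κ * ‖x‖ ^ 2) := by gcongr; exact h.bound x y hxy
      _ = |ε| * κ * ‖x‖ ^ 2 := by ring
      _ ≤ _ := by gcongr
  by_contra! hc
  have hx : 0 < ‖x‖ := lt_of_le_of_lt (by positivity) hc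
  nlinarith

/-- `R` is the resolvent `(1 - ε A)⁻¹`. -/
def IsResolvent (G : Submodule ℝ (X × X)) (ε : ℝ) (R : X →L[ℝ] X) : Prop :=
  ∀ z, (R z, ε⁻¹ • (R z - z)) ∈ G

theorem exists_resolvent (h : IsQuasiSkew G κ) {ε : ℝ} (h0 : ε ≠ 0) (hε : |ε| * κ ≤ 1 / 2) :
    ∃ R : X →L[ℝ] X, IsResolvent G ε R := by
  choose r s hG hr using h.surj ε h0 hε
  have huniq : ∀ x y z, (x, y) ∈ G → x - ε • y = z → x = r z := fun x y z hxy hz => by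
    have h1 := h.norm_le hε (G.sub_mem hxy (hG z))
    have e : x - r z - ε • (y - s z) = 0 := by
      rw [smul_sub, ← sub_eq_zero.2 (hz.trans (hr z).symm)]; abel
    rw [e] at h1
    simpa [sub_eq_zero] using h1
  let L : X →ₗ[ℝ] X :=
    { toFun := r
      map_add' := fun x y => (huniq _ _ _ (G.add_mem (hG x) (hG y)) (by
        have h1 := hr x
        have h2 := hr y
        simp only [smul_add]
        nth_rewrite 3 [← h1]
        nth_rewrite 3 [← h2]
        abel)).symm
      map_smul' := fun c x => (huniq _ _ _ (G.smul_mem c (hG x)) (by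
        change c • r x - ε • c • s x = c • x
        rw [smul_comm, ← smul_sub, hr])).symm }
  refine ⟨L.mkContinuous 2 fun z => ?_, fun z => ?_⟩
  · have := h.norm_le hε (hG z)
    rwa [hr] at this
  · have e : ε⁻¹ • (r z - z) = s z := by
      have : r z - z = ε • s z := by
        nth_rewrite 2 [← hr z]; abel
      rw [this, inv_smul_smul₀ h0]
    change (r z, ε⁻¹ • (r z - z)) ∈ G
    rw [e]
    exact hG z

theorem resolvent_norm_le (h : IsQuasiSkew G κ) {ε : ℝ} (h0 : ε ≠ 0) (hε : |ε| * κ ≤ 1 / 2)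
    {R : X →L[ℝ] X} (hR : IsResolvent G ε R) (z : X) : ‖R z‖ ≤ 2 * ‖z‖ := by
  have := h.norm_le hε (hR z)
  rwa [smul_inv_smul₀ h0, sub_sub_cancel] at this

/-- The resolvent is also a left inverse on the domain, because `norm_le` makes `1 - ε A` injective.
-/
theorem resolvent_apply (h : IsQuasiSkew G κ) {ε : ℝ} (h0 : ε ≠ 0) (hε : |ε| * κ ≤ 1 / 2)
    {R : X →L[ℝ] X} (hR : IsResolvent G ε R) {x y : X} (hxy : (x, y) ∈ G) :
    R (x - ε • y) = x := by
  have h1 := h.norm_le hε (G.sub_mem (hR (x - ε • y)) hxy)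
  have e : R (x - ε • y) - x - ε • (ε⁻¹ • (R (x - ε • y) - (x - ε • y)) - y) = 0 := by
    rw [smul_sub, smul_inv_smul₀ h0]; abel
  simp only [e] at h1
  simpa [sub_eq_zero] using h1

/-- The resolvent commutes with `A`: both `R y` and `A R x` equal `ε⁻¹ • (R x - x)`. -/
theorem resolvent_mem (h : IsQuasiSkew G κ) {ε : ℝ} (h0 : ε ≠ 0) (hε : |ε| * κ ≤ 1 / 2)
    {R : X →L[ℝ] X} (hR : IsResolvent G ε R) {x y : X} (hxy : (x, y) ∈ G) :
    (R x, R y) ∈ G := by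
  have h1 := hR x
  have h2 : R y = ε⁻¹ • (R x - x) := by
    have h3 := h.resolvent_apply h0 hε hR hxy
    rw [map_sub, map_smul] at h3
    nth_rewrite 2 [← h3]
    rw [sub_sub_cancel, inv_smul_smul₀ h0]
  rwa [h2]

theorem resolvent_commute (h : IsQuasiSkew G κ) {ε δ : ℝ} (h0 : ε ≠ 0) (hε : |ε| * κ ≤ 1 / 2)
    (hδ0 : δ ≠ 0) (hδ : |δ| * κ ≤ 1 / 2) {R Q : X →L[ℝ] X} (hR : IsResolvent G ε R)
    (hQ : IsResolvent G δ Q) : Commute R Q := by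
  ext z
  have h1 := h.resolvent_apply hδ0 hδ hQ (h.resolvent_mem h0 hε hR (hQ z))
  rw [← map_smul, ← map_sub, smul_inv_smul₀ hδ0, sub_sub_cancel] at h1
  exact h1.symm

/-- A vector orthogonal to the domain has the form `x - ε • y` with `y = A x`. Pairing it with `x`
gives `‖x‖ ^ 2 ≤ ‖x‖ ^ 2 / 4`, so `x = 0`, and then `y = 0`. -/
theorem dense_domain (h : IsQuasiSkew G κ) [CompleteSpace X] :
    Dense {x : X | ∃ y, (x, y) ∈ G} := by
  set ε : ℝ := 1 / (4 * (κ + 1)) with hεd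
  have hκ := h.nonneg
  have h0 : 0 < ε := by positivity
  have hε' : ε * κ ≤ 1 / 4 := by
    rw [hεd, div_mul_eq_mul_div, div_le_div_iff₀ (by positivity) (by positivity)]; nlinarith
  have hε : |ε| * κ ≤ 1 / 2 := by rw [abs_of_pos h0]; linarith
  have hK : (G.map (LinearMap.fst ℝ X X)).topologicalClosure = ⊤ := by
    rw [Submodule.topologicalClosure_eq_top_iff, Submodule.eq_bot_iff]
    intro z hz
    obtain ⟨x, y, hxy, rfl⟩ := h.surj ε h0.ne' hε z
    have h1 : ⟪x, x - ε • y⟫_ℝ = 0 := by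
      refine (Submodule.mem_orthogonal _ _).1 hz x ?_
      exact ⟨(x, y), hxy, rfl⟩
    rw [inner_sub_right, inner_smul_right, real_inner_self_eq_norm_sq, real_inner_comm] at h1
    have h2 := (le_abs_self _).trans (h.bound x y hxy)
    have hx : x = 0 := by
      have h3 : ε * ⟪y, x⟫_ℝ ≤ ε * (κ * ‖x‖ ^ 2) := by gcongr
      have : ‖x‖ ^ 2 ≤ 0 := by nlinarith [sq_nonneg ‖x‖]
      simpa using this
    subst hx
    rw [h.single y hxy]
    simp
  have hd := (Submodule.dense_iff_topologicalClosure_eq_top).2 hK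
  refine hd.mono ?_
  rintro _ ⟨⟨x, y⟩, hxy, rfl⟩
  exact ⟨y, hxy⟩

/-- On the domain `R n x - x = ε n • R n y` tends to 0; density and the uniform bound 2 on the
resolvents do the rest. -/
theorem tendsto_resolvent (h : IsQuasiSkew G κ) [CompleteSpace X] {ε : ℕ → ℝ}
    (h0 : ∀ n, ε n ≠ 0) (hε : ∀ n, |ε n| * κ ≤ 1 / 2) (hlim : Tendsto ε atTop (𝓝 0))
    {R : ℕ → X →L[ℝ] X} (hR : ∀ n, IsResolvent G (ε n) (R n)) (z : X) :
    Tendsto (fun n => R n z) atTop (𝓝 z) := by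
  rw [Metric.tendsto_atTop]
  intro δ hδ
  obtain ⟨x, ⟨y, hxy⟩, hx⟩ := h.dense_domain.exists_dist_lt z (ε := δ / 6) (by positivity)
  have hb : ∀ n, ‖R n x - x‖ ≤ |ε n| * (2 * ‖y‖) := fun n => by
    have e : R n x - x = ε n • R n y := by
      have h3 := h.resolvent_apply (h0 n) (hε n) (hR n) hxy
      rw [map_sub, map_smul] at h3
      nth_rewrite 2 [← h3]
      abel
    rw [e, norm_smul, Real.norm_eq_abs]
    gcongr
    exact h.resolvent_norm_le (h0 n) (hε n) (hR n) y
  have hl : Tendsto (fun n => |ε n| * (2 * ‖y‖)) atTop (𝓝 0) := by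
    have := hlim.abs.mul_const (2 * ‖y‖)
    simpa using this
  obtain ⟨N, hN⟩ := Metric.tendsto_atTop.1 hl (δ / 2) (by positivity)
  refine ⟨N, fun n hn => ?_⟩
  have h1 : ‖R n x - x‖ < δ / 2 := (hb n).trans_lt ((le_abs_self _).trans_lt (by
    simpa [Real.dist_eq] using hN n hn))
  rw [dist_eq_norm] at hx ⊢
  have h2 := h.resolvent_norm_le (h0 n) (hε n) (hR n) (z - x)
  have e : R n z - z = R n (z - x) + (R n x - x) - (z - x) := by rw [map_sub]; abel
  rw [e]
  have := norm_sub_le (R n (z - x) + (R n x - x)) (z - x)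
  have := norm_add_le (R n (z - x)) (R n x - x)
  linarith

/-- The Yosida type approximation `A (1 - ε² A²)⁻¹` has a form bound independent of `ε`. -/
theorem abs_inner_resolvent_sub_le (h : IsQuasiSkew G κ) {ε : ℝ} (h0 : ε ≠ 0)
    (hε : |ε| * κ ≤ 1 / 2) {R Q : X →L[ℝ] X} (hR : IsResolvent G ε R)
    (hQ : IsResolvent G (-ε) Q) (z : X) :
    |⟪((2 * ε)⁻¹ • (R - Q)) z, z⟫_ℝ| ≤ 20 * κ * ‖z‖ ^ 2 := by
  have hε' : |-ε| * κ ≤ 1 / 2 := by rwa [abs_neg]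
  have hn0 := neg_ne_zero.2 h0
  have hκ := h.nonneg
  -- Formally `x = (1 - ε² A²)⁻¹ z`, `y = A x` is the approximation applied to `z`, and below `w = A
  -- y`, so that `z = x - ε² w`.
  set x := R (Q z) with hx
  set y := (2 * ε)⁻¹ • (R z - Q z) with hy
  have hRz := h.resolvent_norm_le h0 hε hR z
  have hQz := h.resolvent_norm_le hn0 hε' hQ z
  have hcomm : Q (R z) = x :=
    (DFunLike.congr_fun (h.resolvent_commute h0 hε hn0 hε' hR hQ).eq z).symm
  have hxn : ‖x‖ ≤ 4 * ‖z‖ := by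
    have := h.resolvent_norm_le h0 hε hR (Q z)
    linarith
  -- `x - ε A x = Q z` and `x + ε A x = R z`
  have m1 : (x, ε⁻¹ • (x - Q z)) ∈ G := hR (Q z)
  have m2 : (x, (-ε)⁻¹ • (x - R z)) ∈ G := by rw [← hcomm]; exact hQ (R z)
  have e12 : ε⁻¹ • (x - Q z) = (-ε)⁻¹ • (x - R z) := by
    have := h.single _ (by
      have := G.sub_mem m1 m2
      rwa [Prod.mk_sub_mk, sub_self] at this)
    exact sub_eq_zero.1 this
  have ex : (2 : ℝ) • x = R z + Q z := by
    have h1 := congrArg (fun v => ε • v) e12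
    simp only [smul_inv_smul₀ h0] at h1
    rw [inv_neg, neg_smul, smul_neg, smul_inv_smul₀ h0] at h1
    rw [two_smul]
    have : x + x - (R z + Q z) = (x - Q z) - -(x - R z) := by abel
    rw [← sub_eq_zero, this, h1, sub_self]
  have ey : ε⁻¹ • (x - Q z) = y := by
    have h1 : x - Q z = (1 / 2 : ℝ) • (R z - Q z) := by
      have h2 : x = (1 / 2 : ℝ) • (R z + Q z) := by rw [← ex, smul_smul]; norm_num
      rw [h2]
      module
    rw [h1, hy, smul_smul]
    congr 1
    field_simp
  rw [ey] at m1
  -- `A y`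
  have m3 : (y, (2 * ε)⁻¹ • (ε⁻¹ • (R z - z) - (-ε)⁻¹ • (Q z - z))) ∈ G :=
    G.smul_mem ((2 * ε)⁻¹) (G.sub_mem (hR z) (hQ z))
  set w := (2 * ε)⁻¹ • (ε⁻¹ • (R z - z) - (-ε)⁻¹ • (Q z - z)) with hw
  have ew : z = x - (ε ^ 2) • w := by
    have h1 : (ε ^ 2) • w = (1 / 2 : ℝ) • (R z + Q z - (2 : ℝ) • z) := by
      rw [hw]
      match_scalars <;> field_simp
      ring
    have h2 : x = (1 / 2 : ℝ) • (R z + Q z) := by rw [← ex, smul_smul]; norm_num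
    rw [h1, h2]
    module
  have hyn : |ε| * ‖y‖ ≤ 2 * ‖z‖ := by
    have h1 : ε • y = (1 / 2 : ℝ) • (R z - Q z) := by
      rw [hy, smul_smul]
      congr 1
      field_simp
    rw [← Real.norm_eq_abs, ← norm_smul, h1, norm_smul]
    have := norm_sub_le (R z) (Q z)
    norm_num
    linarith
  -- Since `⟪y, z⟫ = ⟪A x, x⟫ - ε² ⟪A y, y⟫`, the form bound of `A` applies twice. With `‖x‖ ≤ 4
  -- ‖z‖` and `|ε| ‖y‖ ≤ 2 ‖z‖` the constant is `16 + 4 = 20`.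
  have b1 := h.bound _ _ m1
  have b2 := h.bound _ _ m3
  have et : ⟪y, z⟫_ℝ = ⟪y, x⟫_ℝ - ε ^ 2 * ⟪w, y⟫_ℝ := by
    nth_rewrite 1 [ew]
    rw [inner_sub_right, inner_smul_right, real_inner_comm w y]
  change |⟪y, z⟫_ℝ| ≤ _
  rw [et]
  have hyn2 : ε ^ 2 * ‖y‖ ^ 2 ≤ 4 * ‖z‖ ^ 2 := by
    have := pow_le_pow_left₀ (by positivity) hyn 2
    rw [mul_pow, sq_abs, mul_pow] at this
    linarith
  have hxn2 : ‖x‖ ^ 2 ≤ 16 * ‖z‖ ^ 2 := by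
    have := pow_le_pow_left₀ (by positivity) hxn 2
    rw [mul_pow] at this
    linarith
  calc |⟪y, x⟫_ℝ - ε ^ 2 * ⟪w, y⟫_ℝ| ≤ |⟪y, x⟫_ℝ| + |ε ^ 2 * ⟪w, y⟫_ℝ| := abs_sub _ _
    _ = |⟪y, x⟫_ℝ| + ε ^ 2 * |⟪w, y⟫_ℝ| := by rw [abs_mul, abs_of_nonneg (sq_nonneg ε)]
    _ ≤ κ * ‖x‖ ^ 2 + ε ^ 2 * (κ * ‖y‖ ^ 2) := by gcongr
    _ = κ * (‖x‖ ^ 2 + ε ^ 2 * ‖y‖ ^ 2) := by ring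
    _ ≤ κ * (16 * ‖z‖ ^ 2 + 4 * ‖z‖ ^ 2) := by gcongr
    _ = 20 * κ * ‖z‖ ^ 2 := by ring

variable [CompleteSpace X]

/-- A quasi-skew-adjoint operator generates a strongly continuous group. -/
theorem exists_group (h : IsQuasiSkew G κ) :
    ∃ S : ℝ → X →L[ℝ] X, S 0 = ContinuousLinearMap.id ℝ X ∧
      (∀ s t, S (s + t) = (S s).comp (S t)) ∧
      (∀ t x, ‖S t x‖ ≤ Real.exp (20 * κ * |t|) * ‖x‖) ∧
      (∀ x, Continuous fun t => S t x) ∧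
      ∀ x y, Tendsto (fun t : ℝ => t⁻¹ • (S t x - x)) (𝓝[≠] 0) (𝓝 y) ↔ (x, y) ∈ G := by
  have hκ := h.nonneg
  set ε : ℕ → ℝ := fun n => 1 / (2 * (κ + 1)) * (1 / ((n : ℝ) + 1)) with hεd
  have hpos : ∀ n, 0 < ε n := fun n => by positivity
  have hε : ∀ n, |ε n| * κ ≤ 1 / 2 := fun n => by
    rw [abs_of_pos (hpos n)]
    have h1 : 1 / ((n : ℝ) + 1) ≤ 1 := by
      rw [div_le_one (by positivity)]; linarith [(Nat.cast_nonneg n : (0 : ℝ) ≤ n)]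
    calc ε n * κ ≤ 1 / (2 * (κ + 1)) * 1 * κ := by simp only [hεd]; gcongr
      _ ≤ 1 / 2 := by
        rw [mul_one, div_mul_eq_mul_div, div_le_div_iff₀ (by positivity) (by positivity)]
        linarith
  have hlim : Tendsto ε atTop (𝓝 0) := by
    have := (tendsto_one_div_add_atTop_nhds_zero_nat (𝕜 := ℝ)).const_mul (1 / (2 * (κ + 1)))
    simpa [hεd] using this
  have h0 : ∀ n, ε n ≠ 0 := fun n => (hpos n).ne'
  have hn0 : ∀ n, -ε n ≠ 0 := fun n => neg_ne_zero.2 (h0 n)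
  have hε' : ∀ n, |-ε n| * κ ≤ 1 / 2 := fun n => by rw [abs_neg]; exact hε n
  choose R hR using fun n => h.exists_resolvent (h0 n) (hε n)
  choose Q hQ using fun n => h.exists_resolvent (hn0 n) (hε' n)
  have hRl := h.tendsto_resolvent h0 hε hlim hR
  have hQl := h.tendsto_resolvent hn0 hε' (by simpa using hlim.neg) hQ
  -- The approximations use `R` and `Q` symmetrically in the sign of `ε`: this gives a two-sided
  -- form bound, hence a group for positive and negative times at once.
  set B : ℕ → X →L[ℝ] X := fun n => (2 * ε n)⁻¹ • (R n - Q n) with hB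
  have hBl : ∀ x y, (x, y) ∈ G → Tendsto (fun n => B n x) atTop (𝓝 y) := fun x y hxy => by
    have e : ∀ n, B n x = (1 / 2 : ℝ) • (R n y + Q n y) := fun n => by
      have h1 := h.resolvent_apply (h0 n) (hε n) (hR n) hxy
      have h2 := h.resolvent_apply (hn0 n) (hε' n) (hQ n) hxy
      rw [map_sub, map_smul, sub_eq_iff_eq_add] at h1 h2
      simp only [hB, smul_apply, sub_apply]
      rw [h1, h2]
      have := h0 n
      match_scalars <;> field_simp
      ring
    simp_rw [e]
    have := ((hRl y).add (hQl y)).const_smul (1 / 2 : ℝ)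
    convert this using 2
    module
  have hcomm : ∀ n m, Commute (B n) (B m) := fun n m => by
    have c1 := h.resolvent_commute (h0 n) (hε n) (h0 m) (hε m) (hR n) (hR m)
    have c2 := h.resolvent_commute (h0 n) (hε n) (hn0 m) (hε' m) (hR n) (hQ m)
    have c3 := h.resolvent_commute (hn0 n) (hε' n) (h0 m) (hε m) (hQ n) (hR m)
    have c4 := h.resolvent_commute (hn0 n) (hε' n) (hn0 m) (hε' m) (hQ n) (hQ m)
    exact (((c1.sub_right c2).sub_left (c3.sub_right c4)).smul_left _).smul_right _
  obtain ⟨S, hS0, hSadd, hSb, hSc, hSi⟩ := exists_limit_group (C := 20 * κ) (by positivity) hcomm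
    (fun n z => h.abs_inner_resolvent_sub_le (h0 n) (hε n) (hR n) (hQ n) z) h.dense_domain
    (fun x ⟨y, hxy⟩ => ⟨y, hBl x y hxy⟩)
  have hgen : ∀ x y, (x, y) ∈ G → HasDerivAt (fun t => S t x) y 0 := fun x y hxy => by
    have e : (fun t => S t x) = fun t => (∫ s in (0 : ℝ)..t, S s y) + x := by
      ext t
      rw [← hSi x y (hBl x y hxy) t, sub_add_cancel]
    rw [e]
    have := ((hSc y).integral_hasStrictDerivAt 0 0).hasDerivAt.add_const x
    simpa [hS0] using this
  have hslope : ∀ x y, Tendsto (fun t : ℝ => t⁻¹ • (S t x - x)) (𝓝[≠] 0) (𝓝 y) ↔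
      HasDerivAt (fun t => S t x) y 0 := fun x y => by
    rw [hasDerivAt_iff_tendsto_slope]
    simp [hS0, slope_fun_def]
  refine ⟨S, hS0, hSadd, hSb, hSc, fun x y => ⟨fun ht => ?_, fun hxy => ?_⟩⟩
  · have hd := (hslope x y).1 ht
    -- The generator of `S` extends `A`, and equality follows from surjectivity of `1 - δ A`: choose
    -- `x₀` in the domain with `x₀ - δ A x₀ = x - δ y`. The difference `d = x - x₀` satisfies `d = δ
    -- d'`, with `d'` the velocity of its orbit at 0. The growth rate `20 κ` and the choice `20 κ δ
    -- ≤ 1/2` force `d = 0`.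
    set δ : ℝ := 1 / (40 * (κ + 1)) with hδd
    have hδ : 0 < δ := by positivity
    have hδκ : δ * κ ≤ 1 / 40 := by
      rw [hδd, div_mul_eq_mul_div, div_le_div_iff₀ (by positivity) (by positivity)]; nlinarith
    obtain ⟨x₀, y₀, hxy₀, hz⟩ := h.surj δ hδ.ne' (by rw [abs_of_pos hδ]; linarith) (x - δ • y)
    have hd2 : HasDerivAt (fun t => S t (x - x₀)) (y - y₀) 0 := by
      simpa [Pi.sub_def] using hd.sub (hgen x₀ y₀ hxy₀)
    have hdy : x - x₀ = δ • (y - y₀) := by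
      rw [smul_sub, sub_eq_sub_iff_sub_eq_sub, ← hz]
    set d := x - x₀ with hdd
    have key : ⟪y - y₀, d⟫_ℝ ≤ 20 * κ * ‖d‖ ^ 2 := by
      -- This function vanishes at 0 and is nonnegative for `t > 0` by the growth bound, so its
      -- derivative at 0 is nonnegative.
      have h1 : HasDerivAt (fun t => Real.exp (2 * (20 * κ) * t) * ‖d‖ ^ 2 - ‖S t d‖ ^ 2)
          (2 * (20 * κ) * ‖d‖ ^ 2 - 2 * ⟪y - y₀, d⟫_ℝ) 0 := by
        have e1 : HasDerivAt (fun t : ℝ => Real.exp (2 * (20 * κ) * t)) (2 * (20 * κ)) 0 := by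
          simpa using ((hasDerivAt_id (0 : ℝ)).const_mul (2 * (20 * κ))).exp
        have e2 := hd2.norm_sq
        simp only [hS0, ContinuousLinearMap.id_apply] at e2
        rw [real_inner_comm] at e2
        exact (e1.mul_const _).sub e2
      have h2 := (hasDerivWithinAt_iff_tendsto_slope' (by simp)).1
        (h1.hasDerivWithinAt (s := Ioi 0))
      have h3 := ge_of_tendsto (b := (0 : ℝ)) h2 (by
        filter_upwards [self_mem_nhdsWithin] with t ht
        have htp : (0 : ℝ) < t := ht
        have hb := hSb t d
        rw [abs_of_pos htp] at hb
        have hb2 := pow_le_pow_left₀ (norm_nonneg _) hb 2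
        rw [mul_pow, ← Real.exp_nat_mul] at hb2
        simp only [slope_def_field, hS0, ContinuousLinearMap.id_apply, mul_zero, Real.exp_zero,
          one_mul, sub_self, sub_zero]
        refine div_nonneg ?_ htp.le
        rw [sub_nonneg]
        refine hb2.trans_eq ?_
        push_cast
        ring_nf)
      linarith
    have hd0 : d = 0 := by
      have e : ‖d‖ ^ 2 = δ * ⟪y - y₀, d⟫_ℝ := by
        rw [← real_inner_self_eq_norm_sq]
        nth_rewrite 1 [hdy]
        rw [inner_smul_left]; simp
      have : δ * ⟪y - y₀, d⟫_ℝ ≤ δ * (20 * κ * ‖d‖ ^ 2) := by gcongr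
      have : ‖d‖ ^ 2 ≤ 0 := by nlinarith [sq_nonneg ‖d‖]
      simpa using this
    have hy0 : y - y₀ = 0 := by
      have := hdy.symm.trans hd0
      simpa [hδ.ne'] using this
    rw [sub_eq_zero] at hy0
    rw [hdd, sub_eq_zero] at hd0
    rwa [hd0, hy0]
  · exact (hslope x y).2 (hgen x y hxy)

end IsQuasiSkew

end QuasiSkew

/-! ### Transfer to an equivalent norm, and uniqueness of the group -/

section Transfer

variable {X : Type*} [NormedAddCommGroup X] [InnerProductSpace ℝ X] [CompleteSpace X]
  {E : Type*} [NormedAddCommGroup E] [NormedSpace ℝ E] {G : Submodule ℝ (X × X)} {κ : ℝ}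

namespace IsQuasiSkew

/-- `exists_group`, in a space with an equivalent norm. -/
theorem exists_group_of_equiv (h : IsQuasiSkew G κ) (e : X ≃L[ℝ] E) :
    ∃ S : ℝ → E →L[ℝ] E, S 0 = ContinuousLinearMap.id ℝ E ∧
      (∀ s t, S (s + t) = (S s).comp (S t)) ∧
      (∀ x, Continuous fun t => S t x) ∧
      (∀ x y, Tendsto (fun t : ℝ => t⁻¹ • (S t x - x)) (𝓝[≠] 0) (𝓝 y) ↔
        (e.symm x, e.symm y) ∈ G) ∧
      ∃ M : ℝ, 0 ≤ M ∧ ∀ t x, ‖S t x‖ ≤ M * Real.exp (20 * κ * |t|) * ‖x‖ := by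
  obtain ⟨S, h0, hadd, hb, hc, hg⟩ := h.exists_group
  have he : ∀ t U, ((e : X →L[ℝ] E).comp ((S t).comp (e.symm : E →L[ℝ] X))) U
      = e (S t (e.symm U)) := fun _ _ => rfl
  refine ⟨fun t => (e : X →L[ℝ] E).comp ((S t).comp (e.symm : E →L[ℝ] X)), ?_, fun s t => ?_,
    fun U => ?_, fun U V => ?_, ‖(e : X →L[ℝ] E)‖ * ‖(e.symm : E →L[ℝ] X)‖, ?_, fun t U => ?_⟩
  · refine ContinuousLinearMap.ext fun U => ?_
    rw [he, h0]
    simp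
  · refine ContinuousLinearMap.ext fun U => ?_
    change e (S (s + t) (e.symm U)) = e (S s (e.symm (e (S t (e.symm U)))))
    rw [e.symm_apply_apply, hadd]
    rfl
  · simp_rw [he]
    exact e.continuous.comp (hc _)
  · rw [← hg, e.symm.toHomeomorph.isInducing.tendsto_nhds_iff]
    refine iff_of_eq (congrArg (fun F => Tendsto F _ _) (funext fun t => ?_))
    change e.symm (t⁻¹ • (e (S t (e.symm U)) - U)) = _
    rw [map_smul, map_sub, e.symm_apply_apply]
  · positivity
  · rw [he]
    calc ‖e (S t (e.symm U))‖ ≤ ‖(e : X →L[ℝ] E)‖ * ‖S t (e.symm U)‖ :=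
          (e : X →L[ℝ] E).le_opNorm _
      _ ≤ ‖(e : X →L[ℝ] E)‖ * (Real.exp (20 * κ * |t|) * ‖e.symm U‖) := by
        gcongr
        exact hb t _
      _ ≤ ‖(e : X →L[ℝ] E)‖ * (Real.exp (20 * κ * |t|) * (‖(e.symm : E →L[ℝ] X)‖ * ‖U‖)) := by
        gcongr
        exact (e.symm : E →L[ℝ] X).le_opNorm _
      _ = _ := by ring

omit [CompleteSpace X] in
-- The domain is invariant because `S t` commutes with the difference quotients at 0.
theorem group_apply_mem {e : X ≃L[ℝ] E} {S : ℝ → E →L[ℝ] E}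
    (hS : ∀ s t, S (s + t) = (S s).comp (S t))
    (hg : ∀ x y, Tendsto (fun t : ℝ => t⁻¹ • (S t x - x)) (𝓝[≠] 0) (𝓝 y) ↔
      (e.symm x, e.symm y) ∈ G) {x y : E} (h : (e.symm x, e.symm y) ∈ G) (t : ℝ) :
    (e.symm (S t x), e.symm (S t y)) ∈ G := by
  rw [← hg] at h ⊢
  have h1 := ((S t).continuous.tendsto y).comp h
  refine h1.congr fun s => ?_
  rw [Function.comp_apply, map_smul, map_sub, ← ContinuousLinearMap.comp_apply,
    ← ContinuousLinearMap.comp_apply, ← hS, ← hS, add_comm]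

omit [CompleteSpace X] in
theorem group_hasDerivAt {e : X ≃L[ℝ] E} {S : ℝ → E →L[ℝ] E}
    (hS : ∀ s t, S (s + t) = (S s).comp (S t))
    (hg : ∀ x y, Tendsto (fun t : ℝ => t⁻¹ • (S t x - x)) (𝓝[≠] 0) (𝓝 y) ↔
      (e.symm x, e.symm y) ∈ G) {x y : E} (h : (e.symm x, e.symm y) ∈ G) (t : ℝ) :
    HasDerivAt (fun s => S s x) (S t y) t := by
  have h1 := (hg _ _).2 (group_apply_mem hS hg h t)
  rw [hasDerivAt_iff_tendsto_slope_zero]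
  refine h1.congr fun s => ?_
  rw [← ContinuousLinearMap.comp_apply, ← hS, add_comm]

/-- The group generated by a quasi-skew-adjoint operator is unique. -/
theorem group_unique (h : IsQuasiSkew G κ) (e : X ≃L[ℝ] E) {S Q : ℝ → E →L[ℝ] E}
    (hS0 : S 0 = ContinuousLinearMap.id ℝ E) (hQ0 : Q 0 = ContinuousLinearMap.id ℝ E)
    (hS : ∀ s t, S (s + t) = (S s).comp (S t)) (hQ : ∀ s t, Q (s + t) = (Q s).comp (Q t))
    (hSg : ∀ x y, Tendsto (fun t : ℝ => t⁻¹ • (S t x - x)) (𝓝[≠] 0) (𝓝 y) ↔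
      (e.symm x, e.symm y) ∈ G)
    (hQg : ∀ x y, Tendsto (fun t : ℝ => t⁻¹ • (Q t x - x)) (𝓝[≠] 0) (𝓝 y) ↔
      (e.symm x, e.symm y) ∈ G) : S = Q := by
  have hdom : ∀ x y t, (e.symm x, e.symm y) ∈ G → S t x = Q t x := fun x y t hxy => by
    -- The difference of the two orbits solves `u' = A u`, `u 0 = 0` in the Hilbert norm, so the
    -- energy Gronwall inequality makes it vanish. Density of the domain then gives all vectors.
    have hd : ∀ t, HasDerivAt (fun t => e.symm (S t x - Q t x)) (e.symm (S t y - Q t y)) t :=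
      fun t => (e.symm : E →L[ℝ] X).hasFDerivAt.comp_hasDerivAt t
        ((group_hasDerivAt hS hSg hxy t).sub (group_hasDerivAt hQ hQg hxy t))
    have hn := norm_le_exp_mul_abs_of_inner_deriv_le hd (C := κ) (fun t => by
      refine h.bound _ _ ?_
      have := G.sub_mem (group_apply_mem hS hSg hxy t) (group_apply_mem hQ hQg hxy t)
      rwa [Prod.mk_sub_mk, ← map_sub, ← map_sub] at this) t
    rw [hS0, hQ0, sub_self, map_zero, norm_zero, mul_zero] at hn
    have := norm_le_zero_iff.1 hn
    rwa [map_eq_zero_iff _ e.symm.injective, sub_eq_zero] at this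
  have hdense : Dense (e '' {x | ∃ y, (x, y) ∈ G}) :=
    e.surjective.denseRange.dense_image e.continuous h.dense_domain
  funext t
  refine ContinuousLinearMap.ext fun U => ?_
  refine congrFun ((S t).continuous.ext_on hdense (Q t).continuous ?_) U
  rintro _ ⟨x, ⟨y, hxy⟩, rfl⟩
  exact hdom _ (e y) t (by simpa using hxy)

end IsQuasiSkew

end Transfer

/-! ### One-dimensional Sobolev space: primitives, traces, integration by parts -/

section Sobolev

theorem absolutelyContinuousOnInterval_add_primitive {l c : ℝ} {g : ℝ → ℝ}
    (hg : IntervalIntegrable g volume 0 l) :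
    AbsolutelyContinuousOnInterval (fun x => c + ∫ s in (0 : ℝ)..x, g s) 0 l := by
  have h := hg.absolutelyContinuousOnInterval_intervalIntegral (c := 0) (by simp)
  have hc : AbsolutelyContinuousOnInterval (fun _ : ℝ => c) 0 l :=
    (LipschitzWith.const c).lipschitzOnWith.absolutelyContinuousOnInterval
  exact hc.add h

theorem ae_deriv_add_primitive {l c : ℝ} (hl : 0 ≤ l) {g : ℝ → ℝ}
    (hg : IntervalIntegrable g volume 0 l) :
    ∀ᵐ x ∂volume.restrict (Ioo 0 l), deriv (fun x => c + ∫ s in (0 : ℝ)..x, g s) x = g x := by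
  rw [ae_restrict_iff' measurableSet_Ioo]
  filter_upwards [hg.ae_hasDerivAt_integral] with x hx hxm
  have hx' : x ∈ uIcc 0 l := by rw [uIcc_of_le hl]; exact Ioo_subset_Icc_self hxm
  exact ((hx hx' 0 (by simp)).const_add c).deriv

/-- Integration by parts for two primitives of integrable functions. -/
theorem integral_mul_primitive {l c d : ℝ} (hl : 0 ≤ l) {g h : ℝ → ℝ}
    (hg : IntervalIntegrable g volume 0 l) (hh : IntervalIntegrable h volume 0 l) :
    ∫ x in Ioo 0 l, (c + ∫ s in (0 : ℝ)..x, g s) * h x =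
      (c + ∫ s in (0 : ℝ)..l, g s) * (d + ∫ s in (0 : ℝ)..l, h s) - c * d
        - ∫ x in Ioo 0 l, g x * (d + ∫ s in (0 : ℝ)..x, h s) := by
  have key := (absolutelyContinuousOnInterval_add_primitive (c := c)
    hg).integral_mul_deriv_eq_deriv_mul (absolutelyContinuousOnInterval_add_primitive (c := d) hh)
  simp only [intervalIntegral.integral_same, add_zero] at key
  have hI : ∀ f : ℝ → ℝ, ∫ x in (0 : ℝ)..l, f x = ∫ x in Ioo 0 l, f x := fun f => by
    rw [intervalIntegral.integral_of_le hl, integral_Ioc_eq_integral_Ioo]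
  have e1 : ∫ x in Ioo 0 l, (c + ∫ s in (0 : ℝ)..x, g s) * h x
      = ∫ x in Ioo 0 l, (c + ∫ s in (0 : ℝ)..x, g s)
        * deriv (fun x => d + ∫ s in (0 : ℝ)..x, h s) x := by
    refine integral_congr_ae ?_
    filter_upwards [ae_deriv_add_primitive (c := d) hl hh] with x hx
    rw [hx]
  have e2 : ∫ x in Ioo 0 l, g x * (d + ∫ s in (0 : ℝ)..x, h s)
      = ∫ x in Ioo 0 l, deriv (fun x => c + ∫ s in (0 : ℝ)..x, g s) x
        * (d + ∫ s in (0 : ℝ)..x, h s) := by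
    refine integral_congr_ae ?_
    filter_upwards [ae_deriv_add_primitive (c := c) hl hg] with x hx
    rw [hx]
  rw [e1, e2, ← hI, ← hI, key]

/-- The lemma of du Bois-Reymond. -/
theorem ae_eq_const_of_integral_mul_deriv_eq_zero {l : ℝ} (hl : 0 < l) {z : ℝ → ℝ}
    (hz : IntegrableOn z (Ioo 0 l))
    (h : ∀ φ : ℝ → ℝ, ContDiff ℝ ∞ φ → HasCompactSupport φ → tsupport φ ⊆ Ioo 0 l →
      ∫ x in Ioo 0 l, z x * deriv φ x = 0) :
    ∃ c : ℝ, ∀ᵐ x ∂volume.restrict (Ioo 0 l), z x = c := by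
  -- A test function of unit integral supported inside the interval; the constant is the integral of
  -- `z` against it.
  let f : ContDiffBump (l / 2 : ℝ) := ⟨l / 8, l / 4, by positivity, by linarith⟩
  set ψ : ℝ → ℝ := f.normed volume with hψ
  have hψd : ContDiff ℝ ∞ ψ := f.contDiff_normed
  have hψc : HasCompactSupport ψ := f.hasCompactSupport_normed
  have hψt : tsupport ψ = Metric.closedBall (l / 2) (l / 4) := f.tsupport_normed_eq
  have hψs : tsupport ψ ⊆ Ioo 0 l := by
    rw [hψt, Real.closedBall_eq_Icc]
    exact Icc_subset_Ioo (by linarith) (by linarith)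
  have hψi : ∫ x, ψ x = 1 := f.integral_normed
  have hmul : ∀ η : ℝ → ℝ, Continuous η → HasCompactSupport η → IntegrableOn (fun x => z x * η x)
      (Ioo 0 l) := fun η hη hc => by
    obtain ⟨C, hC⟩ := hc.exists_bound_of_continuous hη
    exact Integrable.mul_bdd hz hη.aestronglyMeasurable (Eventually.of_forall hC)
  have hset : ∀ η k : ℝ → ℝ, tsupport η ⊆ Ioo 0 l →
      ∫ x in Ioo 0 l, η x * k x = ∫ x, η x * k x := fun η k hη =>
    setIntegral_eq_integral_of_forall_compl_eq_zero fun x hx => by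
      rw [image_eq_zero_of_notMem_tsupport fun hx' => hx (hη hx'), zero_mul]
  set c := ∫ x in Ioo 0 l, z x * ψ x with hc
  refine ⟨c, ?_⟩
  rw [ae_restrict_iff' measurableSet_Ioo]
  have hloc : LocallyIntegrableOn (fun x => z x - c) (Ioo 0 l) :=
    (hz.locallyIntegrableOn).sub ((locallyIntegrable_const c).locallyIntegrableOn _)
  have key := isOpen_Ioo.ae_eq_zero_of_integral_contDiff_smul_eq_zero hloc (fun η hη hηc hηs => ?_)
  · filter_upwards [key] with x hx hxm
    exact sub_eq_zero.1 (hx hxm)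
  set m := ∫ x, η x with hm
  -- Subtracting `m * ψ` makes the integral zero, so that the primitive of `ρ` is again a test
  -- function and the hypothesis applies to it.
  set ρ : ℝ → ℝ := fun x => η x - m * ψ x with hρ
  have hρd : ContDiff ℝ ∞ ρ := hη.sub (contDiff_const.mul hψd)
  have hηint : Integrable η := hη.continuous.integrable_of_hasCompactSupport hηc
  have hψint : Integrable ψ := hψd.continuous.integrable_of_hasCompactSupport hψc
  have hρi : ∫ x, ρ x = 0 := by
    rw [hρ, integral_sub hηint (hψint.const_mul m), integral_const_mul, hψi]
    simp [hm]
  set K := tsupport η ∪ tsupport ψ with hK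
  have hKc : IsCompact K := hηc.isCompact.union hψc.isCompact
  have hKn : K.Nonempty := ⟨l / 2, Or.inr (by rw [hψt]; exact Metric.mem_closedBall_self (by positivity))⟩
  have hKs : K ⊆ Ioo 0 l := union_subset hηs hψs
  set a := sInf K with ha
  set b := sSup K with hb
  have haK : a ∈ K := hKc.sInf_mem hKn
  have hbK : b ∈ K := hKc.sSup_mem hKn
  have hρz : ∀ x, x ∉ Icc a b → ρ x = 0 := fun x hx => by
    have hxK : x ∉ K := fun hxK => hx ⟨csInf_le hKc.bddBelow hxK, le_csSup hKc.bddAbove hxK⟩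
    rw [hK, mem_union, not_or] at hxK
    simp [hρ, image_eq_zero_of_notMem_tsupport hxK.1, image_eq_zero_of_notMem_tsupport hxK.2]
  set φ : ℝ → ℝ := fun x => ∫ s in (0 : ℝ)..x, ρ s with hφ
  have hφd : ∀ x, HasDerivAt φ (ρ x) x := fun x =>
    (hρd.continuous.integral_hasStrictDerivAt 0 x).hasDerivAt
  have hφ' : deriv φ = ρ := funext fun x => (hφd x).deriv
  have hφc : ContDiff ℝ ∞ φ := by
    rw [contDiff_infty_iff_deriv, hφ']
    exact ⟨fun x => (hφd x).differentiableAt, hρd⟩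
  -- To the left of `a` the integrand vanishes; to the right of `b` the integral has already reached
  -- its total value, zero.
  have hφs : Function.support φ ⊆ Icc a b := by
    intro x hx
    by_contra hxm
    refine hx ?_
    rw [mem_Icc, not_and_or, not_le, not_le] at hxm
    rcases hxm with hxa | hxb
    · refine intervalIntegral.integral_zero_ae (Eventually.of_forall fun s hs => hρz s fun hs' => ?_)
      rw [mem_uIoc] at hs
      have := (hKs haK).1
      rcases hs with hs | hs <;> linarith [hs'.1, hs.1, hs.2]
    · have : Function.support ρ ⊆ Ioc 0 x := fun s hs => by
        have hs' : s ∈ Icc a b := by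
          by_contra hcon
          exact hs (hρz s hcon)
        exact ⟨(hKs haK).1.trans_le hs'.1, hs'.2.trans hxb.le⟩
      change ∫ s in (0 : ℝ)..x, ρ s = 0
      rw [intervalIntegral.integral_eq_integral_of_support_subset this, hρi]
  have hφt : tsupport φ ⊆ Icc a b := closure_minimal hφs isClosed_Icc
  have h0 := h φ hφc (HasCompactSupport.of_support_subset_isCompact isCompact_Icc hφs)
    (hφt.trans (Icc_subset_Ioo (hKs haK).1 (hKs hbK).2))
  rw [hφ'] at h0
  have e1 : ∫ x in Ioo 0 l, z x * ρ x = (∫ x in Ioo 0 l, z x * η x) - m * c := by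
    rw [hc, ← integral_const_mul, ← integral_sub (hmul η hη.continuous hηc)
      ((hmul ψ hψd.continuous hψc).const_mul m)]
    refine integral_congr_ae (Eventually.of_forall fun x => ?_)
    simp only [hρ]; ring
  have e2 : ∫ x, η x • (z x - c) = (∫ x in Ioo 0 l, z x * η x) - m * c := by
    simp only [smul_eq_mul]
    rw [← hset η _ hηs]
    have e3 : m = ∫ x in Ioo 0 l, η x := by
      have := hset η (fun _ => 1) hηs
      simpa using this.symm
    rw [e3, ← integral_mul_const, ← integral_sub (hmul η hη.continuous hηc)
      (hηint.integrableOn.mul_const c)]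
    refine integral_congr_ae (Eventually.of_forall fun x => ?_)
    ring
  rw [e2, ← e1, h0]

variable {l : ℝ}

theorem intervalIntegrable_coeFn (hl : 0 ≤ l) (g : L2Int l) : IntervalIntegrable g volume 0 l := by
  rw [intervalIntegrable_iff_integrableOn_Ioo_of_le hl]
  exact (Lp.memLp g).integrable (by norm_num)

theorem inner_eq_setIntegral (g h : L2Int l) : inner ℝ g h = ∫ x in Ioo 0 l, g x * h x := by
  rw [L2.inner_def]
  refine integral_congr_ae (Eventually.of_forall fun x => ?_)
  simp [mul_comm]

theorem continuousOn_add_primitive (hl : 0 ≤ l) (c : ℝ) {g : ℝ → ℝ}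
    (hg : IntervalIntegrable g volume 0 l) :
    ContinuousOn (fun x => c + ∫ s in (0 : ℝ)..x, g s) (Icc 0 l) := by
  have := (absolutelyContinuousOnInterval_add_primitive (c := c) hg).continuousOn
  rwa [uIcc_of_le hl] at this

/-- Integrate by parts against a test function, written as the primitive of its derivative; the
boundary terms vanish. -/
theorem HasWeakDeriv.of_ae_eq_primitive (hl : 0 ≤ l) {y g : L2Int l} {c : ℝ}
    (h : ∀ᵐ x ∂volume.restrict (Ioo 0 l), y x = c + ∫ s in (0 : ℝ)..x, g s) :
    HasWeakDeriv l y g := by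
  intro φ hφ hc hs
  have hd : Continuous (deriv φ) := hφ.continuous_deriv (by simp)
  have hz : ∀ x, x ∉ Ioo 0 l → φ x = 0 := fun x hx =>
    image_eq_zero_of_notMem_tsupport fun hx' => hx (hs hx')
  have hint : ∀ x, ∫ s in (0 : ℝ)..x, deriv φ s = φ x := fun x => by
    rw [intervalIntegral.integral_deriv_eq_sub (fun x _ => hφ.differentiable (by simp) x)
      (hd.intervalIntegrable _ _), hz 0 (by simp), sub_zero]
  have key := integral_mul_primitive (c := c) (d := 0) hl (intervalIntegrable_coeFn hl g)
    (hd.intervalIntegrable 0 l)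
  simp only [hint, hz l (by simp), zero_add, mul_zero, sub_zero, zero_sub] at key
  rw [← key]
  refine integral_congr_ae ?_
  filter_upwards [h] with x hx
  rw [hx]

/-- The elements of `H¹(0,l)` are the primitives of their weak derivatives. -/
theorem HasWeakDeriv.ae_eq_primitive (hl : 0 < l) {y g : L2Int l} {a b : ℝ}
    (h : HasWeakDeriv l y g) (hb : HasBoundaryValues l y a b) :
    (∀ᵐ x ∂volume.restrict (Ioo 0 l), y x = a + ∫ s in (0 : ℝ)..x, g s) ∧
      b = a + ∫ s in (0 : ℝ)..l, g s := by
  have hgi := intervalIntegrable_coeFn hl.le g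
  have hpc : ContinuousOn (fun x => ∫ s in (0 : ℝ)..x, g s) (Icc 0 l) := by
    simpa using continuousOn_add_primitive hl.le 0 hgi
  have hpi : IntegrableOn (fun x => ∫ s in (0 : ℝ)..x, g s) (Ioo 0 l) :=
    (hpc.integrableOn_Icc).mono_set Ioo_subset_Icc_self
  have hyi : IntegrableOn y (Ioo 0 l) := (Lp.memLp y).integrable (by norm_num)
  -- The difference of `y` and the primitive of `g` has zero weak derivative.
  obtain ⟨c, hc⟩ := ae_eq_const_of_integral_mul_deriv_eq_zero hl (hyi.sub hpi)
    (fun φ hφ hφc hφs => by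
      have hd : Continuous (deriv φ) := hφ.continuous_deriv (by simp)
      have hz : ∀ x, x ∉ Ioo 0 l → φ x = 0 := fun x hx =>
        image_eq_zero_of_notMem_tsupport fun hx' => hx (hφs hx')
      have hint : ∀ x, ∫ s in (0 : ℝ)..x, deriv φ s = φ x := fun x => by
        rw [intervalIntegral.integral_deriv_eq_sub (fun x _ => hφ.differentiable (by simp) x)
          (hd.intervalIntegrable _ _), hz 0 (by simp), sub_zero]
      have key := integral_mul_primitive (c := 0) (d := 0) hl.le hgi (hd.intervalIntegrable 0 l)
      simp only [hint, hz l (by simp), zero_add, mul_zero, sub_zero, zero_sub] at key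
      obtain ⟨C, hC⟩ := hφc.deriv.exists_bound_of_continuous hd
      have e := integral_sub (integrable_mul_test y hd hφc.deriv)
        (Integrable.mul_bdd hpi hd.aestronglyMeasurable (Eventually.of_forall hC))
      rw [key, h φ hφ hφc hφs, sub_self] at e
      refine Eq.trans (integral_congr_ae (Eventually.of_forall fun x => ?_)) e
      simp [sub_mul])
  obtain ⟨w, hw, hyw, rfl, rfl⟩ := hb
  -- Two continuous functions equal almost everywhere agree up to the endpoints, which identifies
  -- the traces.
  have hwc : EqOn w (fun x => c + ∫ s in (0 : ℝ)..x, g s) (Icc 0 l) := by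
    refine Measure.eqOn_Icc_of_ae_eq volume hl.ne ?_ hw (continuousOn_add_primitive hl.le c hgi)
    rw [← restrict_Ioo_eq_restrict_Icc]
    filter_upwards [hyw, hc] with x h1 h2
    rw [← h1, ← h2]
    simp
  have h0 : w 0 = c := by simpa using hwc (left_mem_Icc.2 hl.le)
  rw [h0]
  refine ⟨?_, hwc (right_mem_Icc.2 hl.le)⟩
  filter_upwards [hc] with x hx
  rw [← hx]
  simp

/-- Every `g ∈ L²(0,l)` is the weak derivative of an element of `H¹(0,l)` with prescribed value
at `0`. -/
theorem exists_H1 (hl : 0 < l) (c : ℝ) (g : L2Int l) :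
    ∃ u : H1 l, dx u = g ∧ (toL2 u).snd.fst = c := by
  have hgi := intervalIntegrable_coeFn hl.le g
  have hpc := continuousOn_add_primitive hl.le c hgi
  obtain ⟨C, hC⟩ := isCompact_Icc.exists_bound_of_continuousOn hpc
  have hmem : MemLp (fun x => c + ∫ s in (0 : ℝ)..x, g s) 2 (volume.restrict (Ioo 0 l)) := by
    refine MemLp.of_bound ((hpc.mono Ioo_subset_Icc_self).aestronglyMeasurable
      measurableSet_Ioo) C ?_
    rw [ae_restrict_iff' measurableSet_Ioo]
    exact Eventually.of_forall fun x hx => hC x (Ioo_subset_Icc_self hx)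
  refine ⟨⟨WithLp.toLp 2 (WithLp.toLp 2 (hmem.toLp _,
    WithLp.toLp 2 (c, c + ∫ s in (0 : ℝ)..l, g s)), g), ?_, ?_⟩, rfl, rfl⟩
  · exact HasWeakDeriv.of_ae_eq_primitive hl.le (MemLp.coeFn_toLp hmem)
  · exact ⟨_, hpc, MemLp.coeFn_toLp hmem, by simp, rfl⟩

/-- Integration by parts characterizes the elements of `ℍ¹`. -/
theorem mem_H1_iff (hl : 0 < l) (p : WithLp 2 (L2Space l × L2Int l)) :
    p ∈ H1 l ↔ ∀ w : H1 l, inner ℝ p.snd (toL2 w).fst + inner ℝ p.fst.fst (dx w)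
      = p.fst.snd.snd * (toL2 w).snd.snd - p.fst.snd.fst * (toL2 w).snd.fst := by
  have key : ∀ p ∈ H1 l, ∀ w : H1 l, inner ℝ p.snd (toL2 w).fst + inner ℝ p.fst.fst (dx w)
      = p.fst.snd.snd * (toL2 w).snd.snd - p.fst.snd.fst * (toL2 w).snd.fst := by
    rintro p ⟨hp1, hp2⟩ w
    obtain ⟨hpa, hpb⟩ := hp1.ae_eq_primitive hl hp2
    obtain ⟨hwa, hwb⟩ := HasWeakDeriv.ae_eq_primitive hl w.2.1 w.2.2
    have h := integral_mul_primitive (c := p.fst.snd.fst) (d := (toL2 w).snd.fst) hl.le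
      (intervalIntegrable_coeFn hl.le p.snd) (intervalIntegrable_coeFn hl.le (dx w))
    have e1 : inner ℝ p.snd (toL2 w).fst = ∫ x in Ioo 0 l, p.snd x *
        ((toL2 w).snd.fst + ∫ s in (0 : ℝ)..x, dx w s) := by
      rw [inner_eq_setIntegral]
      refine integral_congr_ae ?_
      filter_upwards [hwa] with x hx
      exact congrArg _ hx
    have e2 : inner ℝ p.fst.fst (dx w) = ∫ x in Ioo 0 l, (p.fst.snd.fst
        + ∫ s in (0 : ℝ)..x, p.snd s) * dx w x := by
      rw [inner_eq_setIntegral]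
      refine integral_congr_ae ?_
      filter_upwards [hpa] with x hx
      rw [hx]
    have e3 : (toL2 w).snd.snd = (toL2 w).snd.fst + ∫ s in (0 : ℝ)..l, dx w s := hwb
    rw [e1, e2, h, e3, hpb]
    ring
  refine ⟨key p, fun h => ?_⟩
  -- Compare `p` with the element `q` of `ℍ¹` having the same derivative and the same value at 0;
  -- only the function and the value at `l` remain to be matched.
  obtain ⟨q, hq, hq0⟩ := exists_H1 hl p.fst.snd.fst p.snd
  have hdiff : ∀ w : H1 l, inner ℝ (p.fst.fst - (toL2 q).fst) (dx w)
      = (p.fst.snd.snd - (toL2 q).snd.snd) * (toL2 w).snd.snd := fun w => by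
    have h1 := h w
    have h2 := key q q.2 w
    change inner ℝ (dx q) _ + inner ℝ (toL2 q).fst _ = (toL2 q).snd.snd * _
      - (toL2 q).snd.fst * _ at h2
    rw [hq, hq0] at h2
    rw [inner_sub_left]
    linarith
  have hb : p.fst.snd.snd = (toL2 q).snd.snd := by
    obtain ⟨w, hw, hw0⟩ := exists_H1 hl 1 (0 : L2Int l)
    have h1 := hdiff w
    -- Integration by parts of `w` against itself, with zero derivative and value 1 at 0, gives
    -- `w(l)² = 1`; hence the trace at `l` can be tested.
    have h2 := key w w.2 w
    change inner ℝ (dx w) _ + inner ℝ (toL2 w).fst _ = (toL2 w).snd.snd * _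
      - (toL2 w).snd.fst * _ at h2
    rw [hw, inner_zero_left, inner_zero_right, hw0] at h2
    rw [hw, inner_zero_right] at h1
    have h3 : (toL2 w).snd.snd ≠ 0 := fun h3 => by rw [h3] at h2; norm_num at h2
    exact sub_eq_zero.1 ((mul_eq_zero.1 h1.symm).resolve_right h3)
  have hf : p.fst.fst = (toL2 q).fst := by
    -- A test element whose derivative is the remaining difference makes that difference orthogonal
    -- to itself.
    obtain ⟨w, hw, -⟩ := exists_H1 hl 0 (p.fst.fst - (toL2 q).fst)
    have h1 := hdiff w
    rw [hw, hb, sub_self, zero_mul, inner_self_eq_zero] at h1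
    exact sub_eq_zero.1 h1
  have : p = q := by
    refine WithLp.ofLp_injective 2 (Prod.ext ?_ hq.symm)
    refine WithLp.ofLp_injective 2 (Prod.ext hf ?_)
    exact WithLp.ofLp_injective 2 (Prod.ext hq0.symm hb)
  rw [this]
  exact q.2

/-- The integration-by-parts identities are closed conditions in `p`, one for each test element. -/
theorem isClosed_H1 (hl : 0 < l) : IsClosed (H1 l : Set (WithLp 2 (L2Space l × L2Int l))) := by
  have : (H1 l : Set (WithLp 2 (L2Space l × L2Int l))) = ⋂ w : H1 l, {p |
      inner ℝ p.snd (toL2 w).fst + inner ℝ p.fst.fst (dx w)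
        = p.fst.snd.snd * (toL2 w).snd.snd - p.fst.snd.fst * (toL2 w).snd.fst} := by
    ext p
    rw [SetLike.mem_coe, mem_H1_iff hl, mem_iInter]
    rfl
  rw [this]
  exact isClosed_iInter fun w => isClosed_eq (by fun_prop) (by fun_prop)

theorem completeSpace_H1 (hl : 0 < l) : CompleteSpace (H1 l) :=
  (isClosed_H1 hl).completeSpace_coe

theorem inner_L2Space (u v : L2Space l) :
    inner ℝ u v = inner ℝ u.fst v.fst + u.snd.fst * v.snd.fst + u.snd.snd * v.snd.snd := by
  rw [WithLp.prod_inner_apply, WithLp.prod_inner_apply]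
  simp only [RCLike.inner_apply, conj_trivial, add_assoc]
  simp [mul_comm]

/-- The weak form of the operator `𝒜`. -/
theorem waveOp_iff (hl : 0 < l) (U V : EnergySpace l) :
    WaveOp l U V ↔ toL2 V.1 = U.2 ∧
      ∀ w : H1 l, inner ℝ (dx U.1) (dx w) = -inner ℝ V.2 (toL2 w) := by
  refine and_congr_right fun _ => ⟨?_, fun h => ?_⟩
  · rintro ⟨p, h1, h2, h3, h4⟩ w
    have := (mem_H1_iff hl p).1 p.2 w
    change inner ℝ (dx p) _ + inner ℝ (toL2 p).fst _ = (toL2 p).snd.snd * _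
      - (toL2 p).snd.fst * _ at this
    rw [inner_L2Space, h2, h3, h4, ← h1]
    linarith
  -- The weak identity is exactly the criterion of `mem_H1_iff` for `u_x`, with derivative and
  -- traces read off from `V`; testing with all of `ℍ¹` recovers the regularity and the boundary
  -- conditions together.
  · refine ⟨⟨WithLp.toLp 2 (WithLp.toLp 2 (dx U.1, WithLp.toLp 2 (V.2.snd.fst, -V.2.snd.snd)),
      V.2.fst), (mem_H1_iff hl _).2 fun w => ?_⟩, rfl, rfl, rfl, (neg_neg _).symm⟩
    have := h w
    rw [inner_L2Space] at this
    change inner ℝ V.2.fst _ + inner ℝ (dx U.1) _ = -V.2.snd.snd * _ - V.2.snd.fst * _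
    linarith

end Sobolev

/-! ### The wave operator is quasi-skew and generates a unique group -/

section WaveGroup

variable {l : ℝ}

/-- The embedding of `ℍ¹` into `𝕃²` as a continuous linear map. -/
noncomputable def toL2L (l : ℝ) : H1 l →L[ℝ] L2Space l :=
  (WithLp.fstL 2 ℝ (L2Space l) (L2Int l)).comp (H1 l).subtypeL

/-- The weak derivative on `ℍ¹` as a continuous linear map. -/
noncomputable def dxL (l : ℝ) : H1 l →L[ℝ] L2Int l :=
  (WithLp.sndL 2 ℝ (L2Space l) (L2Int l)).comp (H1 l).subtypeL

@[simp] theorem toL2L_apply (u : H1 l) : toL2L l u = toL2 u := rfl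

@[simp] theorem dxL_apply (u : H1 l) : dxL l u = dx u := rfl

theorem inner_H1 (u w : H1 l) :
    inner ℝ u w = inner ℝ (toL2 u) (toL2 w) + inner ℝ (dx u) (dx w) := by
  rw [Submodule.coe_inner, WithLp.prod_inner_apply]
  rfl

theorem norm_toL2_le (u : H1 l) : ‖toL2 u‖ ≤ ‖u‖ := by
  refine le_of_sq_le_sq ?_ (norm_nonneg u)
  rw [← real_inner_self_eq_norm_sq, ← real_inner_self_eq_norm_sq, inner_H1]
  linarith [real_inner_self_nonneg (x := dx u)]

/-- An element of `ℍ¹` is determined by its `L²` component. -/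
theorem eq_zero_of_toL2_fst_eq_zero (hl : 0 < l) {u : H1 l} (h : (toL2 u).fst = 0) : u = 0 := by
  obtain ⟨h1, h2⟩ := HasWeakDeriv.ae_eq_primitive hl u.2.1 u.2.2
  set c := (toL2 u).snd.fst with hc
  have hgi := intervalIntegrable_coeFn hl.le (dx u)
  have hz : EqOn (fun x => c + ∫ s in (0 : ℝ)..x, dx u s) (fun _ => 0) (Icc 0 l) := by
    refine Measure.eqOn_Icc_of_ae_eq volume hl.ne ?_ (continuousOn_add_primitive hl.le c hgi)
      continuousOn_const
    rw [← restrict_Ioo_eq_restrict_Icc]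
    have h0 : ((toL2 u).fst : ℝ → ℝ) =ᵐ[volume.restrict (Ioo 0 l)] 0 := by
      rw [h]; exact Lp.coeFn_zero _ _ _
    filter_upwards [h1, h0] with x hx hx0
    exact hx.symm.trans hx0
  have hc0 : c = 0 := by simpa using hz (left_mem_Icc.2 hl.le)
  have hb0 : (toL2 u).snd.snd = 0 := h2.trans (hz (right_mem_Icc.2 hl.le))
  have hg0 : dx u = 0 := by
    refine Lp.ext ?_
    have hmem : ∀ᵐ x ∂volume.restrict (Ioo 0 l), x ∈ Ioo 0 l := ae_restrict_mem measurableSet_Ioo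
    filter_upwards [ae_deriv_add_primitive (c := c) hl.le hgi, hmem,
      Lp.coeFn_zero ℝ 2 (volume.restrict (Ioo 0 l))] with x hx hxm hx0
    rw [← hx, hx0]
    have : (fun x => c + ∫ s in (0 : ℝ)..x, dx u s) =ᶠ[𝓝 x] fun _ => 0 := by
      filter_upwards [isOpen_Ioo.mem_nhds hxm] with y hy
      exact hz (Ioo_subset_Icc_self hy)
    rw [this.deriv_eq]
    simp
  refine Subtype.ext (WithLp.ofLp_injective 2 (Prod.ext ?_ hg0))
  refine WithLp.ofLp_injective 2 (Prod.ext h ?_)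
  exact WithLp.ofLp_injective 2 (Prod.ext hc0 hb0)

/-- The energy space with an equivalent Hilbert norm. -/
abbrev EnergyHilbert (l : ℝ) : Type := WithLp 2 (H1 l × L2Space l)

/-- The graph of `𝒜`, in the weak formulation, in the Hilbert space `EnergyHilbert l`. -/
def waveGraph (l : ℝ) : Submodule ℝ (EnergyHilbert l × EnergyHilbert l) where
  carrier := {p | toL2L l p.2.fst = p.1.snd ∧
    ∀ w : H1 l, inner ℝ (dxL l p.1.fst) (dx w) = -inner ℝ p.2.snd (toL2 w)}
  add_mem' := fun {p q} hp hq => ⟨by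
    simp only [Prod.fst_add, Prod.snd_add, WithLp.add_fst, WithLp.add_snd, map_add, hp.1, hq.1],
    fun w => by
      simp only [Prod.fst_add, Prod.snd_add, WithLp.add_fst, WithLp.add_snd, map_add,
        inner_add_left, hp.2 w, hq.2 w]
      ring⟩
  zero_mem' := ⟨by simp only [Prod.fst_zero, Prod.snd_zero, WithLp.zero_fst, WithLp.zero_snd,
      map_zero], fun w => by
      simp only [Prod.fst_zero, Prod.snd_zero, WithLp.zero_fst, WithLp.zero_snd, map_zero,
        inner_zero_left, neg_zero]⟩
  smul_mem' := fun c p hp => ⟨by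
    simp only [Prod.smul_fst, Prod.smul_snd, WithLp.smul_fst, WithLp.smul_snd, map_smul, hp.1],
    fun w => by
      simp only [Prod.smul_fst, Prod.smul_snd, WithLp.smul_fst, WithLp.smul_snd, map_smul,
        inner_smul_left, hp.2 w, mul_neg]⟩

theorem mem_waveGraph_iff (hl : 0 < l) (U V : EnergyHilbert l) :
    (U, V) ∈ waveGraph l ↔ WaveOp l U.ofLp V.ofLp :=
  (waveOp_iff hl _ _).symm

/-- Lax–Milgram: since `ε ^ 2 ≤ 1`, the bilinear form is coercive with constant `ε ^ 2`. -/
theorem exists_forall_inner_add_inner_eq {V H K : Type*}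
    [NormedAddCommGroup V] [InnerProductSpace ℝ V] [CompleteSpace V]
    [NormedAddCommGroup H] [InnerProductSpace ℝ H] [CompleteSpace H]
    [NormedAddCommGroup K] [InnerProductSpace ℝ K] (J : V →L[ℝ] H) (D : V →L[ℝ] K)
    (hJD : ∀ u : V, inner ℝ u u = inner ℝ (J u) (J u) + inner ℝ (D u) (D u))
    {ε : ℝ} (h0 : ε ≠ 0) (hε : |ε| ≤ 1) (f : H) :
    ∃ u : V, ∀ w : V, ε ^ 2 * inner ℝ (D u) (D w) + inner ℝ (J u) (J w) = inner ℝ f (J w) := by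
  let B : V →L[ℝ] V →L[ℝ] ℝ :=
    ε ^ 2 • (innerSL ℝ (E := K)).bilinearComp D D + (innerSL ℝ (E := H)).bilinearComp J J
  have hB : ∀ u w, B u w = ε ^ 2 * inner ℝ (D u) (D w) + inner ℝ (J u) (J w) :=
    fun u w => rfl
  have hco : IsCoercive B := by
    refine ⟨ε ^ 2, by positivity, fun u => ?_⟩
    rw [hB, mul_assoc, ← sq, ← real_inner_self_eq_norm_sq u, hJD]
    have h1 : ε ^ 2 ≤ 1 := by
      rw [← sq_abs]; exact pow_le_one₀ (abs_nonneg ε) hε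
    have := real_inner_self_nonneg (x := J u)
    nlinarith
  refine ⟨hco.continuousLinearEquivOfBilin.symm (J.adjoint f), fun w => ?_⟩
  rw [← hB, ← hco.continuousLinearEquivOfBilin_apply, ContinuousLinearEquiv.apply_symm_apply,
    ContinuousLinearMap.adjoint_inner_left]

/-- The weak equation for the displacement that is left after eliminating the velocity from `(1 - ε
𝒜) U = z`. -/
theorem exists_elliptic_solution (hl : 0 < l) {ε : ℝ} (h0 : ε ≠ 0) (hε : |ε| ≤ 1)
    (f : L2Space l) : ∃ u : H1 l, ∀ w : H1 l,
      ε ^ 2 * inner ℝ (dx u) (dx w) + inner ℝ (toL2 u) (toL2 w) = inner ℝ f (toL2 w) := by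
  have := completeSpace_H1 hl
  exact exists_forall_inner_add_inner_eq (toL2L l) (dxL l) (fun u => inner_H1 u u) h0 hε f

theorem isQuasiSkew_waveGraph (hl : 0 < l) : IsQuasiSkew (X := EnergyHilbert l) (waveGraph l) 1 where
  nonneg := zero_le_one
  single := fun V hV => by
    obtain ⟨h1, p, h2, h3, h4, h5⟩ := (mem_waveGraph_iff hl 0 V).1 hV
    have hp : p = 0 := eq_zero_of_toL2_fst_eq_zero hl h2
    have hV1 : V.fst = 0 := eq_zero_of_toL2_fst_eq_zero hl (by
      rw [show toL2 V.fst = 0 from h1]; rfl)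
    subst hp
    refine WithLp.ofLp_injective 2 (Prod.ext hV1 ?_)
    refine WithLp.ofLp_injective 2 (Prod.ext h3 ?_)
    exact WithLp.ofLp_injective 2 (Prod.ext h4 (h5.trans neg_zero))
  -- Testing the weak form with `y.fst` cancels the derivative terms against the velocity terms;
  -- only `⟪x.snd, toL2 x.fst⟫`, from the `𝕃²` part of the `ℍ¹` norm, survives.
  bound := fun x y ⟨h1, h2⟩ => by
    have h3 := h2 y.fst
    simp only [toL2L_apply, dxL_apply] at h1 h3
    have e : inner ℝ y x = inner ℝ x.snd (toL2 x.fst) := by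
      rw [WithLp.prod_inner_apply]
      change inner ℝ y.fst x.fst + inner ℝ y.snd x.snd = _
      rw [inner_H1, h1, real_inner_comm (dx x.fst), h3, h1]
      ring
    rw [e, one_mul, WithLp.prod_norm_sq_eq_of_L2]
    have h4 := abs_real_inner_le_norm x.snd (toL2 x.fst)
    have h5 := norm_toL2_le x.fst
    have h6 : ‖x.snd‖ * ‖toL2 x.fst‖ ≤ ‖x.snd‖ * ‖x.fst‖ := by gcongr
    nlinarith [sq_nonneg (‖x.snd‖ - ‖x.fst‖), sq_nonneg ‖x.snd‖, sq_nonneg ‖x.fst‖]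
  -- The first row of `(1 - ε 𝒜)(u, v) = z` gives `v = ε⁻¹ (u - z.fst)`; inserted in the second row
  -- and multiplied by `ε`, it becomes the elliptic equation with right-hand side `z.fst + ε z.snd`.
  surj := fun ε h0 hε z => by
    obtain ⟨u, hu⟩ := exists_elliptic_solution hl h0 (by linarith : |ε| ≤ 1)
      (toL2 z.fst + ε • z.snd)
    set v : L2Space l := ε⁻¹ • (toL2L l u - toL2L l z.fst) with hv
    refine ⟨WithLp.toLp 2 (u, v), WithLp.toLp 2 (ε⁻¹ • (u - z.fst), ε⁻¹ • (v - z.snd)),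
      ⟨?_, fun w => ?_⟩, ?_⟩
    · change toL2L l (ε⁻¹ • (u - z.fst)) = v
      rw [map_smul, map_sub]
    · have h := hu w
      change inner ℝ (dx u) (dx w) = -inner ℝ (ε⁻¹ • (v - z.snd)) (toL2 w)
      simp only [hv, toL2L_apply, inner_smul_left, inner_sub_left, inner_add_left,
        conj_trivial] at h ⊢
      field_simp
      linarith
    · refine WithLp.ofLp_injective 2 (Prod.ext ?_ ?_)
      · simp [h0]
      · simp [h0]

/-- The wave operator generates a strongly continuous group of exponential growth. -/
theorem exists_isWaveGroup (hl : 0 < l) : ∃ S : ℝ → EnergySpace l →L[ℝ] EnergySpace l,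
    IsWaveGroup l S ∧ ∃ M : ℝ, 0 ≤ M ∧ ∀ t U, ‖S t U‖ ≤ M * Real.exp (20 * |t|) * ‖U‖ := by
  have := completeSpace_H1 hl
  obtain ⟨S, h0, hadd, hc, hg, M, hM, hb⟩ := (isQuasiSkew_waveGraph hl).exists_group_of_equiv
    (WithLp.prodContinuousLinearEquiv 2 ℝ (H1 l) (L2Space l))
  refine ⟨S, ⟨h0, hadd, hc, fun U V => (hg U V).trans (mem_waveGraph_iff hl _ _)⟩, M, hM, ?_⟩
  simpa only [mul_one] using hb

/-- Needed because a mild solution is defined through some wave group, which might otherwise vary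
from one solution to another. -/
theorem IsWaveGroup.unique (hl : 0 < l) {S Q : ℝ → EnergySpace l →L[ℝ] EnergySpace l}
    (hS : IsWaveGroup l S) (hQ : IsWaveGroup l Q) : S = Q := by
  have := completeSpace_H1 hl
  refine (isQuasiSkew_waveGraph hl).group_unique
    (WithLp.prodContinuousLinearEquiv 2 ℝ (H1 l) (L2Space l)) hS.map_zero hQ.map_zero
    hS.map_add hQ.map_add (fun U V => ?_) (fun U V => ?_)
  · exact (hS.generator U V).trans (mem_waveGraph_iff hl _ _).symm
  · exact (hQ.generator U V).trans (mem_waveGraph_iff hl _ _).symm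

end WaveGroup

/-! ### Time slices of a space-time source as a measurable `L²`-valued function -/

section Slices

open scoped ENNReal

/-- A map into a separable metric space is strongly measurable as soon as all its distances to
points are measurable. -/
theorem stronglyMeasurable_of_measurable_edist {α E : Type*} [MeasurableSpace α]
    [PseudoEMetricSpace E] [SecondCountableTopology E] {f : α → E}
    (h : ∀ c, Measurable fun a => edist (f a) c) : StronglyMeasurable f := by
  borelize E
  refine Measurable.stronglyMeasurable (measurable_of_isOpen fun U hU => ?_)
  let ι := {p : E × ℝ≥0∞ // Metric.eball p.1 p.2 ⊆ U}
  obtain ⟨A, hA, hAU⟩ := TopologicalSpace.isOpen_iUnion_countable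
    (fun i : ι => Metric.eball i.1.1 i.1.2) (fun i => Metric.isOpen_eball)
  have hUe : U = ⋃ i ∈ A, Metric.eball (i : ι).1.1 i.1.2 := by
    rw [hAU]
    refine Subset.antisymm (fun x hx => ?_) (iUnion_subset fun i => i.2)
    obtain ⟨r, hr, hrU⟩ := EMetric.isOpen_iff.1 hU x hx
    exact mem_iUnion.2 ⟨⟨(x, r), hrU⟩, Metric.mem_eball_self hr⟩
  rw [hUe, preimage_iUnion₂]
  exact MeasurableSet.biUnion hA fun i _ => measurableSet_lt (h i.1.1) measurable_const

variable {T l : ℝ}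

theorem slice_of_memLp {F : Lp ℝ 2 (volume.restrict (Ioo (0 : ℝ) T ×ˢ Ioo (0 : ℝ) l))} {t : ℝ}
    (h : MemLp (fun x => F (t, x)) 2 (volume.restrict (Ioo (0 : ℝ) l))) :
    slice F t = h.toLp _ := dif_pos h

theorem aestronglyMeasurable_section
    (F : Lp ℝ 2 (volume.restrict (Ioo (0 : ℝ) T ×ˢ Ioo (0 : ℝ) l))) (t : ℝ) :
    AEStronglyMeasurable (fun x => F (t, x)) (volume.restrict (Ioo (0 : ℝ) l)) :=
  ((Lp.stronglyMeasurable F).comp_measurable measurable_prodMk_left).aestronglyMeasurable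

theorem eLpNorm_two_eq {α E : Type*} [MeasurableSpace α] {μ : Measure α} [NormedAddCommGroup E]
    (f : α → E) : eLpNorm f 2 μ = (∫⁻ x, ‖f x‖ₑ ^ 2 ∂μ) ^ (1 / 2 : ℝ) := by
  rw [eLpNorm_eq_lintegral_rpow_enorm_toReal (by norm_num) (by norm_num)]
  simp

theorem measurable_eLpNorm_section
    (F : Lp ℝ 2 (volume.restrict (Ioo (0 : ℝ) T ×ˢ Ioo (0 : ℝ) l))) (c : L2Int l) :
    Measurable fun t => eLpNorm (fun x => F (t, x) - c x) 2 (volume.restrict (Ioo (0 : ℝ) l)) := by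
  simp_rw [eLpNorm_two_eq]
  refine Measurable.pow_const ?_ _
  have hF : Measurable fun p : ℝ × ℝ => F p - c p.2 :=
    (Lp.stronglyMeasurable F).measurable.sub
      ((Lp.stronglyMeasurable c).measurable.comp measurable_snd)
  exact (hF.enorm.pow_const 2).lintegral_prod_right'

/-- The distance of the slice to a fixed `c` is the norm of a section, measurable in `t` by Tonelli,
except on the measurable set where the slice takes the default value 0. -/
theorem stronglyMeasurable_slice
    (F : Lp ℝ 2 (volume.restrict (Ioo (0 : ℝ) T ×ˢ Ioo (0 : ℝ) l))) :
    StronglyMeasurable fun t => slice F t := by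
  classical
  -- Finiteness of the exponent provides the separability of `L²(0,l)`.
  have : Fact ((2 : ℝ≥0∞) ≠ ⊤) := ⟨by norm_num⟩
  refine stronglyMeasurable_of_measurable_edist fun c => ?_
  have hN : MeasurableSet {t | MemLp (fun x => F (t, x)) 2 (volume.restrict (Ioo (0 : ℝ) l))} := by
    have e : {t | MemLp (fun x => F (t, x)) 2 (volume.restrict (Ioo (0 : ℝ) l))}
        = {t | eLpNorm (fun x => F (t, x)) 2 (volume.restrict (Ioo (0 : ℝ) l)) < ⊤} := by
      ext t
      exact ⟨fun h => h.2, fun h => ⟨aestronglyMeasurable_section F t, h⟩⟩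
    rw [e]
    refine measurableSet_lt ?_ measurable_const
    simp_rw [eLpNorm_two_eq]
    exact (((Lp.stronglyMeasurable F).measurable.enorm.pow_const 2).lintegral_prod_right').pow_const
      _
  have e : (fun t => edist (slice F t) c) = fun t =>
      if t ∈ {t | MemLp (fun x => F (t, x)) 2 (volume.restrict (Ioo (0 : ℝ) l))} then
        eLpNorm (fun x => F (t, x) - c x) 2 (volume.restrict (Ioo (0 : ℝ) l))
      else edist (0 : L2Int l) c := by
    ext t
    split_ifs with h
    · rw [slice_of_memLp h, Lp.edist_def]
      refine eLpNorm_congr_ae ?_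
      filter_upwards [h.coeFn_toLp] with x hx
      simp [hx]
    · rw [mem_ofPred_eq] at h
      rw [slice, dif_neg h]
  rw [e]
  exact Measurable.ite hN (measurable_eLpNorm_section F c) measurable_const

theorem enorm_slice_le (F : Lp ℝ 2 (volume.restrict (Ioo (0 : ℝ) T ×ˢ Ioo (0 : ℝ) l))) (t : ℝ) :
    ‖slice F t‖ₑ ≤ eLpNorm (fun x => F (t, x)) 2 (volume.restrict (Ioo (0 : ℝ) l)) := by
  by_cases h : MemLp (fun x => F (t, x)) 2 (volume.restrict (Ioo (0 : ℝ) l))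
  · rw [slice_of_memLp h, Lp.enorm_def]
    exact (eLpNorm_congr_ae h.coeFn_toLp).le
  · rw [slice, dif_neg h]
    simp

theorem volume_restrict_prod : (volume : Measure (ℝ × ℝ)).restrict (Ioo (0 : ℝ) T ×ˢ Ioo (0 : ℝ) l)
    = (volume.restrict (Ioo (0 : ℝ) T)).prod (volume.restrict (Ioo (0 : ℝ) l)) := by
  rw [Measure.prod_restrict]; rfl

theorem ae_ae_of_ae_restrict_prod {p : ℝ × ℝ → Prop}
    (h : ∀ᵐ z ∂volume.restrict (Ioo (0 : ℝ) T ×ˢ Ioo (0 : ℝ) l), p z) :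
    ∀ᵐ t ∂volume.restrict (Ioo (0 : ℝ) T), ∀ᵐ x ∂volume.restrict (Ioo (0 : ℝ) l), p (t, x) := by
  rw [volume_restrict_prod] at h
  exact Measure.ae_ae_of_ae_prod h

theorem lintegral_restrict_prod {g : ℝ × ℝ → ℝ≥0∞} (hg : Measurable g) :
    ∫⁻ z in Ioo (0 : ℝ) T ×ˢ Ioo (0 : ℝ) l, g z
      = ∫⁻ t in Ioo (0 : ℝ) T, ∫⁻ x in Ioo (0 : ℝ) l, g (t, x) := by
  rw [volume_restrict_prod, lintegral_prod _ hg.aemeasurable]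

/-- Tonelli; finiteness of the right-hand side later gives square-integrable sections for almost
every `t`. -/
theorem lintegral_eLpNorm_section_sq
    (F : Lp ℝ 2 (volume.restrict (Ioo (0 : ℝ) T ×ˢ Ioo (0 : ℝ) l))) :
    ∫⁻ t in Ioo (0 : ℝ) T, eLpNorm (fun x => F (t, x)) 2 (volume.restrict (Ioo (0 : ℝ) l)) ^ 2
      = ‖F‖ₑ ^ 2 := by
  have hsq : ∀ a : ℝ≥0∞, (a ^ (1 / 2 : ℝ)) ^ 2 = a := fun a => by
    rw [← ENNReal.rpow_natCast, ← ENNReal.rpow_mul]; norm_num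
  rw [Lp.enorm_def, eLpNorm_two_eq, hsq]
  simp_rw [eLpNorm_two_eq, hsq]
  rw [lintegral_restrict_prod ((Lp.stronglyMeasurable F).measurable.enorm.pow_const 2)]

theorem ae_memLp_section (F : Lp ℝ 2 (volume.restrict (Ioo (0 : ℝ) T ×ˢ Ioo (0 : ℝ) l))) :
    ∀ᵐ t ∂volume.restrict (Ioo (0 : ℝ) T),
      MemLp (fun x => F (t, x)) 2 (volume.restrict (Ioo (0 : ℝ) l)) := by
  have hm : Measurable fun t =>
      eLpNorm (fun x => F (t, x)) 2 (volume.restrict (Ioo (0 : ℝ) l)) ^ 2 := by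
    simp_rw [eLpNorm_two_eq]
    exact ((((Lp.stronglyMeasurable F).measurable.enorm.pow_const
      2).lintegral_prod_right').pow_const _).pow_const 2
  have h := ae_lt_top hm (μ := volume.restrict (Ioo (0 : ℝ) T))
    (by rw [lintegral_eLpNorm_section_sq]; exact ENNReal.pow_ne_top enorm_ne_top)
  filter_upwards [h] with t ht
  refine ⟨aestronglyMeasurable_section F t, ?_⟩
  exact (ENNReal.pow_lt_top_iff.1 ht).resolve_right (by norm_num)

theorem eLpNorm_slice_le (F : Lp ℝ 2 (volume.restrict (Ioo (0 : ℝ) T ×ˢ Ioo (0 : ℝ) l))) :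
    eLpNorm (fun t => slice F t) 2 (volume.restrict (Ioo (0 : ℝ) T)) ≤ ‖F‖ₑ := by
  have hsq : ∀ a : ℝ≥0∞, (a ^ 2) ^ (1 / 2 : ℝ) = a := fun a => by
    rw [← ENNReal.rpow_natCast, ← ENNReal.rpow_mul]; norm_num
  rw [eLpNorm_two_eq, ← hsq ‖F‖ₑ, ← lintegral_eLpNorm_section_sq]
  gcongr
  exact enorm_slice_le F _

/-- Holds only almost everywhere in `t`: representatives add up to null sets, and slices may take
the default value on a null set of times. -/
theorem slice_add_ae (F F' : Lp ℝ 2 (volume.restrict (Ioo (0 : ℝ) T ×ˢ Ioo (0 : ℝ) l))) :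
    ∀ᵐ t ∂volume.restrict (Ioo (0 : ℝ) T), slice (F + F') t = slice F t + slice F' t := by
  have h := Lp.coeFn_add F F'
  filter_upwards [ae_memLp_section F, ae_memLp_section F', ae_memLp_section (F + F'),
    ae_ae_of_ae_restrict_prod h] with t h1 h2 h3 h4
  rw [slice_of_memLp h1, slice_of_memLp h2, slice_of_memLp h3, ← MemLp.toLp_add]
  exact MemLp.toLp_congr _ _ h4

theorem slice_smul_ae (c : ℝ) (F : Lp ℝ 2 (volume.restrict (Ioo (0 : ℝ) T ×ˢ Ioo (0 : ℝ) l))) :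
    ∀ᵐ t ∂volume.restrict (Ioo (0 : ℝ) T), slice (c • F) t = c • slice F t := by
  have h := Lp.coeFn_smul c F
  filter_upwards [ae_memLp_section F, ae_memLp_section (c • F),
    ae_ae_of_ae_restrict_prod h] with t h1 h2 h3
  rw [slice_of_memLp h1, slice_of_memLp h2, ← MemLp.toLp_const_smul]
  exact MemLp.toLp_congr _ _ h3

end Slices

/-! ### Integrability and linearity of the forcing term -/

section Forcing

open scoped ENNReal

variable {T l : ℝ}

/-- The embedding `(f, g) ↦ (0, (f, g, 0))` of the values of the sources into the energy space. -/
noncomputable def sourceL (l : ℝ) : (L2Int l × ℝ) →L[ℝ] EnergySpace l :=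
  (ContinuousLinearMap.inr ℝ (H1 l) (L2Space l)).comp
    ((WithLp.prodContinuousLinearEquiv 2 ℝ (L2Int l) (WithLp 2 (ℝ × ℝ))).symm.toContinuousLinearMap.comp
      ((ContinuousLinearMap.fst ℝ (L2Int l) ℝ).prod
        ((WithLp.prodContinuousLinearEquiv 2 ℝ ℝ ℝ).symm.toContinuousLinearMap.comp
          ((ContinuousLinearMap.inl ℝ ℝ ℝ).comp (ContinuousLinearMap.snd ℝ (L2Int l) ℝ)))))

theorem forcing_eq (W : Sources T l) (t : ℝ) :
    forcing W t = sourceL l (slice W.fst t, W.snd t) := rfl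

theorem memLp_slice (F : Lp ℝ 2 (volume.restrict (Ioo (0 : ℝ) T ×ˢ Ioo (0 : ℝ) l))) :
    MemLp (fun t => slice F t) 2 (volume.restrict (Ioo (0 : ℝ) T)) :=
  ⟨(stronglyMeasurable_slice F).aestronglyMeasurable,
    (eLpNorm_slice_le F).trans_lt enorm_lt_top⟩

theorem aestronglyMeasurable_forcing (W : Sources T l) :
    AEStronglyMeasurable (forcing W) (volume.restrict (Ioo (0 : ℝ) T)) :=
  (sourceL l).continuous.comp_aestronglyMeasurable
    ((stronglyMeasurable_slice W.fst).aestronglyMeasurable.prodMk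
      (Lp.stronglyMeasurable W.snd).aestronglyMeasurable)

theorem norm_forcing_le (W : Sources T l) (t : ℝ) :
    ‖forcing W t‖ ≤ ‖sourceL l‖ * (‖slice W.fst t‖ + ‖W.snd t‖) := by
  rw [forcing_eq]
  refine ((sourceL l).le_opNorm _).trans ?_
  gcongr
  exact max_le_add_of_nonneg (norm_nonneg _) (norm_nonneg _)

theorem integral_norm_le_of_memLp_two {E : Type*} [NormedAddCommGroup E] {f : ℝ → E}
    (hf : MemLp f 2 (volume.restrict (Ioo (0 : ℝ) T))) :
    ∫ t in Ioo (0 : ℝ) T, ‖f t‖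
      ≤ (eLpNorm f 2 (volume.restrict (Ioo (0 : ℝ) T))).toReal
        * (volume.restrict (Ioo (0 : ℝ) T) univ ^ (1 / 2 : ℝ)).toReal := by
  rw [← ENNReal.toReal_mul, integral_norm_eq_lintegral_enorm hf.1, ← eLpNorm_one_eq_lintegral_enorm]
  refine ENNReal.toReal_mono (ENNReal.mul_ne_top hf.2.ne
    (ENNReal.rpow_ne_top_of_nonneg (by norm_num) (measure_ne_top _ _))) ?_
  have := eLpNorm_le_eLpNorm_mul_rpow_measure_univ (μ := volume.restrict (Ioo (0 : ℝ) T))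
    (p := 1) (q := 2) (by norm_num) hf.1
  refine this.trans_eq ?_
  norm_num

theorem integrable_forcing (W : Sources T l) :
    Integrable (forcing W) (volume.restrict (Ioo (0 : ℝ) T)) := by
  have h1 : Integrable (fun t => slice W.fst t) (volume.restrict (Ioo (0 : ℝ) T)) :=
    (memLp_slice W.fst).integrable (by norm_num)
  have h2 : Integrable (fun t => W.snd t) (volume.restrict (Ioo (0 : ℝ) T)) :=
    (Lp.memLp W.snd).integrable (by norm_num)
  exact ((h1.norm.add h2.norm).const_mul ‖sourceL l‖).mono' (aestronglyMeasurable_forcing W)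
    (Eventually.of_forall fun t => norm_forcing_le W t)

/-- Duhamel's integral needs an `L¹` bound in time; Cauchy–Schwarz on the bounded interval derives
it from the `L²` norm of the sources. -/
theorem exists_integral_norm_forcing_le (T l : ℝ) : ∃ C : ℝ, 0 ≤ C ∧ ∀ W : Sources T l,
    ∫ t in Ioo (0 : ℝ) T, ‖forcing W t‖ ≤ C * ‖W‖ := by
  set m := (volume.restrict (Ioo (0 : ℝ) T) univ ^ (1 / 2 : ℝ)).toReal
  refine ⟨‖sourceL l‖ * (2 * m), by positivity, fun W => ?_⟩
  have i1 : Integrable (fun t => slice W.fst t) (volume.restrict (Ioo (0 : ℝ) T)) :=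
    (memLp_slice W.fst).integrable (by norm_num)
  have i2 : Integrable (fun t => W.snd t) (volume.restrict (Ioo (0 : ℝ) T)) :=
    (Lp.memLp W.snd).integrable (by norm_num)
  have h1 : ∫ t in Ioo (0 : ℝ) T, ‖slice W.fst t‖ ≤ ‖W‖ * m := by
    refine (integral_norm_le_of_memLp_two (memLp_slice W.fst)).trans ?_
    gcongr
    calc (eLpNorm (fun t => slice W.fst t) 2 (volume.restrict (Ioo (0 : ℝ) T))).toReal
        ≤ ‖W.fst‖ₑ.toReal := ENNReal.toReal_mono enorm_ne_top (eLpNorm_slice_le W.fst)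
      _ = ‖W.fst‖ := toReal_enorm _
      _ ≤ ‖W‖ := WithLp.norm_fst_le _ W
  have h2 : ∫ t in Ioo (0 : ℝ) T, ‖W.snd t‖ ≤ ‖W‖ * m := by
    refine (integral_norm_le_of_memLp_two (Lp.memLp W.snd)).trans ?_
    gcongr
    exact WithLp.norm_snd_le _ W
  calc ∫ t in Ioo (0 : ℝ) T, ‖forcing W t‖
      ≤ ∫ t in Ioo (0 : ℝ) T, ‖sourceL l‖ * (‖slice W.fst t‖ + ‖W.snd t‖) :=
        integral_mono (integrable_forcing W).norm ((i1.norm.add i2.norm).const_mul _)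
          fun t => norm_forcing_le W t
    _ = ‖sourceL l‖ * ((∫ t in Ioo (0 : ℝ) T, ‖slice W.fst t‖)
        + ∫ t in Ioo (0 : ℝ) T, ‖W.snd t‖) := by
        rw [integral_const_mul, integral_add i1.norm i2.norm]
    _ ≤ ‖sourceL l‖ * (‖W‖ * m + ‖W‖ * m) := by gcongr
    _ = _ := by ring

theorem forcing_add_ae (W W' : Sources T l) : ∀ᵐ t ∂volume.restrict (Ioo (0 : ℝ) T),
    forcing (W + W') t = forcing W t + forcing W' t := by
  filter_upwards [slice_add_ae W.fst W'.fst, Lp.coeFn_add W.snd W'.snd] with t h1 h2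
  simp_rw [forcing_eq]
  rw [← map_add, WithLp.add_fst, WithLp.add_snd, h1, h2]
  rfl

theorem forcing_smul_ae (c : ℝ) (W : Sources T l) : ∀ᵐ t ∂volume.restrict (Ioo (0 : ℝ) T),
    forcing (c • W) t = c • forcing W t := by
  filter_upwards [slice_smul_ae c W.fst, Lp.coeFn_smul c W.snd] with t h1 h2
  simp_rw [forcing_eq]
  rw [← map_smul, WithLp.smul_fst, WithLp.smul_snd, h1, h2]
  rfl

end Forcing

/-! ### Joint continuity of a strongly continuous family -/

section Group

variable {E : Type*} [NormedAddCommGroup E] [NormedSpace ℝ E]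

/-- A strongly continuous, locally bounded family of operators is jointly continuous. -/
theorem continuous_uncurry_of_strongly_continuous {S : ℝ → E →L[ℝ] E}
    (hS : ∀ x, Continuous fun t => S t x) {m : ℝ → ℝ} (hm : Continuous m)
    (hb : ∀ t x, ‖S t x‖ ≤ m t * ‖x‖) : Continuous fun p : ℝ × E => S p.1 p.2 := by
  rw [continuous_iff_continuousAt]
  rintro ⟨t₀, x₀⟩
  have h1 : Tendsto (fun p : ℝ × E => S p.1 x₀) (𝓝 (t₀, x₀)) (𝓝 (S t₀ x₀)) :=
    ((hS x₀).comp continuous_fst).tendsto (t₀, x₀)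
  have h2 : Tendsto (fun p : ℝ × E => S p.1 (p.2 - x₀)) (𝓝 (t₀, x₀)) (𝓝 0) := by
    refine squeeze_zero_norm (fun p => hb p.1 _) ?_
    have : Continuous fun p : ℝ × E => m p.1 * ‖p.2 - x₀‖ := by fun_prop
    simpa using this.tendsto (t₀, x₀)
  have h3 := h1.add h2
  rw [add_zero] at h3
  refine h3.congr fun p => ?_
  rw [map_sub, add_sub_cancel]

end Group

/-! ### Calculus of the quadratic functional `½ ‖K W + b‖²` -/

section Quadratic

variable {E H : Type*} [NormedAddCommGroup E] [InnerProductSpace ℝ E] [CompleteSpace E]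
  [NormedAddCommGroup H] [InnerProductSpace ℝ H] [CompleteSpace H]

omit [CompleteSpace E] [CompleteSpace H] in
theorem contDiff_half_norm_sq_affine (K : E →L[ℝ] H) (b : H) {n : WithTop ℕ∞} :
    ContDiff ℝ n fun W => 1 / 2 * ‖K W + b‖ ^ 2 :=
  contDiff_const.mul ((K.contDiff.add contDiff_const).norm_sq ℝ)

theorem gradient_half_norm_sq_affine (K : E →L[ℝ] H) (b : H) (W : E) :
    gradient (fun W => 1 / 2 * ‖K W + b‖ ^ 2) W = K.adjoint (K W + b) := by
  refine HasGradientAt.gradient ?_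
  rw [hasGradientAt_iff_hasFDerivAt]
  have h1 : HasFDerivAt (fun W => K W + b) K W := K.hasFDerivAt.add_const b
  refine ((h1.norm_sq).const_mul (1 / 2)).congr_fderiv ?_
  ext V
  simp [ContinuousLinearMap.adjoint_inner_left]

/-- The gradient is `K* (K W + b)`, so `b` cancels in the difference and the adjoint moves back to
the other factor. -/
theorem inner_gradient_sub_half_norm_sq_affine (K : E →L[ℝ] H) (b : H) (W₁ W₂ : E) :
    inner ℝ (gradient (fun W => 1 / 2 * ‖K W + b‖ ^ 2) W₁
      - gradient (fun W => 1 / 2 * ‖K W + b‖ ^ 2) W₂) (W₁ - W₂) = ‖K (W₁ - W₂)‖ ^ 2 := by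
  rw [gradient_half_norm_sq_affine, gradient_half_norm_sq_affine, ← map_sub,
    ContinuousLinearMap.adjoint_inner_left, add_sub_add_right_eq_sub, ← map_sub,
    real_inner_self_eq_norm_sq]

omit [CompleteSpace E] [CompleteSpace H] in
theorem convexOn_half_norm_sq_affine (K : E →L[ℝ] H) (b : H) :
    ConvexOn ℝ univ fun W => 1 / 2 * ‖K W + b‖ ^ 2 := by
  have h := (convexOn_univ_norm (E := H)).pow (fun _ _ => norm_nonneg _) 2
  have h1 := ((h.translate_left b).comp_linearMap (K : E →ₗ[ℝ] H)).smul
    (by norm_num : (0 : ℝ) ≤ 1 / 2)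
  simpa [Function.comp_def] using h1

end Quadratic

/-! ### The Duhamel integral and the mild solution -/

section Duhamel

variable {T l : ℝ} {S : ℝ → EnergySpace l →L[ℝ] EnergySpace l} {m : ℝ → ℝ}

/-- Joint continuity of `(t, x) ↦ S t x` gives measurability of the integrand, the forcing being
only measurable in time; the growth bound gives domination. -/
theorem intervalIntegrable_duhamel (hS : ∀ x, Continuous fun t => S t x) (hm : Continuous m)
    (hb : ∀ t x, ‖S t x‖ ≤ m t * ‖x‖) (W : Sources T l) {t : ℝ} (ht : t ∈ Icc 0 T) :
    IntervalIntegrable (fun s => S (t - s) (forcing W s)) volume 0 t := by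
  have hc := continuous_uncurry_of_strongly_continuous hS hm hb
  have hsub : volume.restrict (Ioo 0 t) ≤ volume.restrict (Ioo 0 T) :=
    Measure.restrict_mono (Ioo_subset_Ioo_right ht.2) le_rfl
  obtain ⟨C, hC⟩ := (isCompact_Icc (a := (0 : ℝ)) (b := t)).exists_bound_of_continuousOn
    (f := fun s => m (t - s)) (by fun_prop)
  rw [intervalIntegrable_iff_integrableOn_Ioo_of_le ht.1]
  refine (((integrable_forcing W).mono_measure hsub).norm.const_mul C).mono' ?_ ?_
  · exact hc.comp_aestronglyMeasurable ((by fun_prop : Continuous fun s : ℝ => t - s)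
      |>.aestronglyMeasurable.prodMk ((aestronglyMeasurable_forcing W).mono_measure hsub))
  · rw [ae_restrict_iff' measurableSet_Ioo]
    refine Eventually.of_forall fun s hs => (hb _ _).trans ?_
    gcongr
    exact (le_abs_self _).trans (hC s (Ioo_subset_Icc_self hs))

theorem ae_restrict_uIoc {t : ℝ} (ht : t ∈ Icc 0 T) {p : ℝ → Prop}
    (h : ∀ᵐ s ∂volume.restrict (Ioo (0 : ℝ) T), p s) : ∀ᵐ s ∂volume, s ∈ uIoc 0 t → p s := by
  rw [← ae_restrict_iff' measurableSet_uIoc, uIoc_of_le ht.1, ← restrict_Ioo_eq_restrict_Ioc]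
  exact ae_restrict_of_ae_restrict_of_subset (Ioo_subset_Ioo_right ht.2) h

theorem duhamel_add (hS : ∀ x, Continuous fun t => S t x) (hm : Continuous m)
    (hb : ∀ t x, ‖S t x‖ ≤ m t * ‖x‖) (W W' : Sources T l) {t : ℝ} (ht : t ∈ Icc 0 T) :
    ∫ s in (0 : ℝ)..t, S (t - s) (forcing (W + W') s)
      = (∫ s in (0 : ℝ)..t, S (t - s) (forcing W s))
        + ∫ s in (0 : ℝ)..t, S (t - s) (forcing W' s) := by
  rw [← intervalIntegral.integral_add (intervalIntegrable_duhamel hS hm hb W ht)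
    (intervalIntegrable_duhamel hS hm hb W' ht)]
  refine intervalIntegral.integral_congr_ae ?_
  filter_upwards [ae_restrict_uIoc ht (forcing_add_ae W W')] with s hs hst
  rw [hs hst, map_add]

theorem duhamel_smul (c : ℝ) (W : Sources T l) {t : ℝ} (ht : t ∈ Icc 0 T) :
    ∫ s in (0 : ℝ)..t, S (t - s) (forcing (c • W) s)
      = c • ∫ s in (0 : ℝ)..t, S (t - s) (forcing W s) := by
  rw [← intervalIntegral.integral_smul]
  refine intervalIntegral.integral_congr_ae ?_
  filter_upwards [ae_restrict_uIoc ht (forcing_smul_ae c W)] with s hs hst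
  rw [hs hst, map_smul]

theorem exists_norm_duhamel_le (hT : 0 ≤ T) (hm : Continuous m)
    (hb : ∀ t x, ‖S t x‖ ≤ m t * ‖x‖) : ∃ C : ℝ, ∀ W : Sources T l,
    ‖∫ s in (0 : ℝ)..T, S (T - s) (forcing W s)‖ ≤ C * ‖W‖ := by
  obtain ⟨A, hA0, hA⟩ := exists_integral_norm_forcing_le T l
  obtain ⟨C, hC⟩ := (isCompact_Icc (a := (0 : ℝ)) (b := T)).exists_bound_of_continuousOn
    (f := fun s => m (T - s)) (by fun_prop)
  refine ⟨|C| * A, fun W => ?_⟩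
  rw [intervalIntegral.integral_of_le hT, integral_Ioc_eq_integral_Ioo]
  calc ‖∫ s in Ioo 0 T, S (T - s) (forcing W s)‖ ≤ ∫ s in Ioo 0 T, |C| * ‖forcing W s‖ := by
        refine norm_integral_le_of_norm_le ((integrable_forcing W).norm.const_mul |C|) ?_
        rw [ae_restrict_iff' measurableSet_Ioo]
        refine Eventually.of_forall fun s hs => (hb _ _).trans ?_
        gcongr
        exact (le_abs_self _).trans ((hC s (Ioo_subset_Icc_self hs)).trans (le_abs_self C))
    _ = |C| * ∫ s in Ioo 0 T, ‖forcing W s‖ := integral_const_mul _ _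
    _ ≤ |C| * (A * ‖W‖) := by gcongr; exact hA W
    _ = _ := by ring

/-- The source-to-state map at the final time. -/
theorem exists_duhamel_clm (hT : 0 ≤ T) (hS : ∀ x, Continuous fun t => S t x) (hm : Continuous m)
    (hb : ∀ t x, ‖S t x‖ ≤ m t * ‖x‖) : ∃ L : Sources T l →L[ℝ] EnergySpace l, ∀ W,
    L W = ∫ s in (0 : ℝ)..T, S (T - s) (forcing W s) := by
  obtain ⟨C, hC⟩ := exists_norm_duhamel_le (l := l) hT hm hb
  exact ⟨LinearMap.mkContinuous
    { toFun := fun W => ∫ s in (0 : ℝ)..T, S (T - s) (forcing W s)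
      map_add' := fun W W' => duhamel_add hS hm hb W W' (right_mem_Icc.2 hT)
      map_smul' := fun c W => duhamel_smul c W (right_mem_Icc.2 hT) } C hC, fun _ => rfl⟩

/-- Uniqueness of the wave group replaces the existential group by a fixed `S`, common to all
solutions being compared. -/
theorem isMildSolution_iff (hl : 0 < l) (hS : IsWaveGroup l S) {U₀ : EnergySpace l}
    {W : Sources T l} {U : ℝ → EnergySpace l} : IsMildSolution U₀ W U ↔ ∀ t ∈ Icc 0 T,
      IntervalIntegrable (fun s => S (t - s) (forcing W s)) volume 0 t ∧
        U t = S t U₀ + ∫ s in (0 : ℝ)..t, S (t - s) (forcing W s) := by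
  refine ⟨fun ⟨Q, hQ, h⟩ => ?_, fun h => ⟨S, hS, h⟩⟩
  rwa [hS.unique hl hQ]

end Duhamel

end DynWave

/-! ### The cost functional and its gradient -/

theorem lemma4p1 (T l : ℝ) (hT : 0 < T) (hl : 0 < l) :
    -- the mild solutions exist and are unique, so that the objects below are well defined
    (∀ (U₀ : DynWave.EnergySpace l) (W : DynWave.Sources T l),
      ∃ U : ℝ → DynWave.EnergySpace l, DynWave.IsMildSolution U₀ W U ∧
        ∀ V : ℝ → DynWave.EnergySpace l, DynWave.IsMildSolution U₀ W V →
          Set.EqOn V U (Set.Icc 0 T)) ∧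
    -- `U W` is the mild solution for the initial state `U₀` and the sources `W`
    ∀ (U₀ : DynWave.EnergySpace l) (Yδ : DynWave.L2Space l)
      (U : DynWave.Sources T l → ℝ → DynWave.EnergySpace l),
      (∀ W, DynWave.IsMildSolution U₀ W (U W)) →
      -- `𝒥` is continuously Fréchet differentiable
      ContDiff ℝ 1 (DynWave.cost U Yδ) ∧
      -- for the mild solution `D` of the sensitivity problem with sources `δW`
      (∀ (W δW : DynWave.Sources T l) (D : ℝ → DynWave.EnergySpace l),
        DynWave.IsMildSolution 0 δW D →
          Set.EqOn D (U (W + δW) - U W) (Set.Icc 0 T) ∧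
          inner ℝ (gradient (DynWave.cost U Yδ) (W + δW) - gradient (DynWave.cost U Yδ) W) δW
            = ‖DynWave.displacement D T‖ ^ 2 ∧
          (DynWave.displacement D T ≠ 0 →
            0 < inner ℝ
              (gradient (DynWave.cost U Yδ) (W + δW) - gradient (DynWave.cost U Yδ) W) δW)) ∧
      -- `𝒥'` is monotone
      (∀ W₁ W₂ : DynWave.Sources T l,
        0 ≤ inner ℝ
          (gradient (DynWave.cost U Yδ) W₁ - gradient (DynWave.cost U Yδ) W₂) (W₁ - W₂)) ∧
      -- `𝒥` is convex
      ConvexOn ℝ Set.univ (DynWave.cost U Yδ) := by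
  obtain ⟨S, hS, M, -, hb⟩ := DynWave.exists_isWaveGroup hl
  have hm : Continuous fun t : ℝ => M * Real.exp (20 * |t|) := by fun_prop
  have hSc := hS.strongly_continuous
  have hmild := fun {U₀ : DynWave.EnergySpace l} {W : DynWave.Sources T l} {U} =>
    DynWave.isMildSolution_iff (U₀ := U₀) (W := W) (U := U) hl hS
  refine ⟨fun U₀ W => ⟨fun t => S t U₀ + ∫ s in (0 : ℝ)..t, S (t - s) (DynWave.forcing W s),
    hmild.2 fun t ht => ⟨DynWave.intervalIntegrable_duhamel hSc hm hb W ht, rfl⟩,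
    fun V hV t ht => (hmild.1 hV t ht).2⟩, fun U₀ Yδ U hU => ?_⟩
  have hTm : T ∈ Icc 0 T := right_mem_Icc.2 hT.le
  obtain ⟨L, hL⟩ := DynWave.exists_duhamel_clm (l := l) hT.le hSc hm hb
  let P : DynWave.EnergySpace l →L[ℝ] DynWave.L2Space l :=
    (DynWave.toL2L l).comp (ContinuousLinearMap.fst ℝ (DynWave.H1 l) (DynWave.L2Space l))
  -- `K` sends sources to the final displacement with zero initial state; the constant `b` is the
  -- free final displacement minus the data.
  obtain ⟨K, hK⟩ : ∃ K : DynWave.Sources T l →L[ℝ] DynWave.L2Space l, ∀ W, K W = P (L W) :=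
    ⟨P.comp L, fun _ => rfl⟩
  have hcost : DynWave.cost U Yδ = fun W => 1 / 2 * ‖K W + (P (S T U₀) - Yδ)‖ ^ 2 := by
    funext W
    have e : DynWave.displacement (U W) T = P (U W T) := rfl
    rw [DynWave.cost, e, (hmild.1 (hU W) T hTm).2, map_add, ← hL, hK,
      add_comm (P (S T U₀)), add_sub_assoc]
  rw [hcost]
  refine ⟨DynWave.contDiff_half_norm_sq_affine _ _, fun W δW D hD => ?_, fun W₁ W₂ => ?_,
    DynWave.convexOn_half_norm_sq_affine _ _⟩
  · have hDT : DynWave.displacement D T = K δW := by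
      have e : DynWave.displacement D T = P (D T) := rfl
      rw [e, (hmild.1 hD T hTm).2, map_zero, zero_add, ← hL, hK]
    have hgrad := DynWave.inner_gradient_sub_half_norm_sq_affine K (P (S T U₀) - Yδ) (W + δW) W
    rw [add_sub_cancel_left] at hgrad
    rw [hgrad, hDT]
    refine ⟨fun t ht => ?_, rfl, fun h => by positivity⟩
    rw [Pi.sub_apply, (hmild.1 hD t ht).2, (hmild.1 (hU (W + δW)) t ht).2,
      (hmild.1 (hU W) t ht).2, DynWave.duhamel_add hSc hm hb W δW ht, map_zero]
    abel
  · rw [DynWave.inner_gradient_sub_half_norm_sq_affine]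
    positivity
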